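/- **Setting.** Let $\Lambda=\mathbb Z[t^{\pm1}]$. Let $D$ be a diagram of a classical oriented link $L=K_1\cup\dots\cup K_\mu$, with set of arcs $A(D)$ and set of crossings $C(D)$, and let $\kappa(a)=i$ if the arc $a$ belongs to $K_i$. Let $\Lambda_\mu=\mathbb Z[t_1^{\pm1},\dots,t_\mu^{\pm1}]$. The *Alexander module* $M_A(L)$ is the $\Lambda_\mu$-module generated by elements $\gamma(a)$, $a\in A(D)$, with one relation $$(1-t_{\kappa(a_2)})\,\gamma(a_1)+t_{\kappa(a_1)}\,\gamma(a_2)-\gamma(a_3)=0$$ for each crossing, where $a_1$ is the overpassing arc and $a_2$, $a_3$ are the underpassing arcs on the right and on the left of $a_1$, respectively. The *Crowell map* is the $\Lambda_\mu$-linear map $\phi_L:M_A(L)\to\Lambda_\mu$ with $\phi_L(\gamma(a))=t_{\kappa(a)}-1$. The set $U(L)=\{x\in M_A(L)\mid \phi_L(x)+1\text{ is a unit}\}$ is a quandle under $x\triangleright y=(\phi_L(y)+1)x-\phi_L(x)y$, and $Q_A(L)$ is its subquandle generated by the elements $\gamma(a)$, $a\in A(D)$. The *reduced Alexander module* is the $\Lambda$-module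 $M_A^{red}(L)=M_A(L)\otimes_{\Lambda_\mu}\Lambda$, where every $t_i$ acts on $\Lambda$ as $t$, and $Q_A^{red}(L)=\{x\otimes 1\mid x\in Q_A(L)\}\subset M_A^{red}(L)$ is a quandle under $(x\otimes1)\triangleright(y\otimes1)=(x\triangleright y)\otimes1$ (which equals $t(x\otimes1)+(1-t)(y\otimes1)$). Two diagrams represent the same oriented link type if they are connected by Reidemeister moves. **Theorem.** The quandle $Q_A^{red}(L)$, up to quandle isomorphism, is a strictly stronger invariant of classical oriented links than the reduced Alexander module $M_A^{red}(L)$, up to isomorphism of $\Lambda$-modules. That is: 1. If two diagrams represent the same oriented link type, then their quandles $Q_A^{red}$ are isomorphic and their $\Lambda$-modules $M_A^{red}$ are isomorphic. 2. If $L$ and $L'$ are links with $Q_A^{red}(L)\cong Q_A^{red}(L')$ as quandles, then $M_A^{red}(L)\cong M_A^{red}(L')$ as $\Lambda$-modules. 3. Let $L$ be the split union of two Hopf links (each drawn with two negative crossings), and let $L'$ be the split union of an unknot and a chain of three circles (drawn with four positive crossings) in which the middle circle forms a Hopf link with each of the two others, which are not linked with each other. Then $M_A^{red}(L)\cong M_A^{red}(L')$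 as $\Lambda$-modules, but $Q_A^{red}(L)\not\cong Q_A^{red}(L')$ as quandles. -/

import Mathlib

open scoped TensorProduct LaurentPolynomial Quandles

/-! ### Oriented link diagrams

An oriented link diagram is recorded by finitely many marked points on its closed curves.
`next` sends a marked point to the following one along the orientation, so the closed curves are
the cycles of `next`, and the edge that leaves the marked point `p` is denoted by `p` itself.
A crossing consists of two marked points (its overpass and its underpass) and a sign.
A marked point that belongs to no crossing is a plain point of a curve; a closed curve
without crossings carries only plain points. -/

structure GaussDiagram where
  Pt : Type
  Cr : Type
  finite_pt : Finite Pt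
  next : Equiv.Perm Pt
  overPt : Cr → Pt
  underPt : Cr → Pt
  injective : Function.Injective (Sum.elim overPt underPt)
  sign : Cr → ℤˣ

inductive Side : Type
  | left
  | right
  deriving DecidableEq

namespace GaussDiagram

variable (D : GaussDiagram)

/-- The edge that arrives at the marked point `p`. -/
def edgeIn (p : D.Pt) : D.Pt := D.next.symm p

def IsPlain (p : D.Pt) : Prop := ∀ c, D.overPt c ≠ p ∧ D.underPt c ≠ p

/-- Two sides of edges are adjacent when they meet in a corner at a plain point or at a crossing.
At a positive crossing, with both strands pointing upwards, the overpass runs from bottom left to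
top right and the underpass from bottom right to top left; a negative crossing is the mirror
image. -/
inductive SideAdj : D.Pt × Side → D.Pt × Side → Prop
  | plain (p : D.Pt) (h : D.IsPlain p) (s : Side) : SideAdj (D.edgeIn p, s) (p, s)
  | pos_top (c : D.Cr) (h : D.sign c = 1) :
      SideAdj (D.overPt c, .left) (D.underPt c, .right)
  | pos_west (c : D.Cr) (h : D.sign c = 1) :
      SideAdj (D.underPt c, .left) (D.edgeIn (D.overPt c), .left)
  | pos_bottom (c : D.Cr) (h : D.sign c = 1) :
      SideAdj (D.edgeIn (D.overPt c), .right) (D.edgeIn (D.underPt c), .left)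
  | pos_east (c : D.Cr) (h : D.sign c = 1) :
      SideAdj (D.edgeIn (D.underPt c), .right) (D.overPt c, .right)
  | neg_top (c : D.Cr) (h : D.sign c = -1) :
      SideAdj (D.overPt c, .right) (D.underPt c, .left)
  | neg_east (c : D.Cr) (h : D.sign c = -1) :
      SideAdj (D.underPt c, .right) (D.edgeIn (D.overPt c), .right)
  | neg_bottom (c : D.Cr) (h : D.sign c = -1) :
      SideAdj (D.edgeIn (D.overPt c), .left) (D.edgeIn (D.underPt c), .right)
  | neg_west (c : D.Cr) (h : D.sign c = -1) :
      SideAdj (D.edgeIn (D.underPt c), .left) (D.overPt c, .left)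

/-- The faces of the surface into which the 4-valent graph of the diagram embeds cellularly. -/
def Face : Type := Quot D.SideAdj

inductive PieceAdj : D.Pt → D.Pt → Prop
  | edge (p : D.Pt) : PieceAdj p (D.next p)
  | crossing (c : D.Cr) : PieceAdj (D.overPt c) (D.underPt c)

/-- The connected components of the underlying graph of the diagram. -/
def Piece : Type := Quot D.PieceAdj

/-- The diagram can be drawn on a union of spheres, one for each connected component of its graph
(equivalently, in the plane). The graph has `#Pt - #Cr` vertices and `#Pt` edges, so this is
Euler's formula `V - E + F = 2 * #Piece`. -/
def IsPlanar : Prop := Nat.card D.Face = Nat.card D.Cr + 2 * Nat.card D.Piece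

/-! #### Reidemeister moves -/

/-- Forget the crossings in `S`; their marked points become plain points. -/
def erase (S : Set D.Cr) : GaussDiagram where
  Pt := D.Pt
  Cr := {c : D.Cr // c ∉ S}
  finite_pt := D.finite_pt
  next := D.next
  overPt c := D.overPt c
  underPt c := D.underPt c
  injective := by
    have h := D.injective
    rintro (⟨a, ha⟩ | ⟨a, ha⟩) (⟨b, hb⟩ | ⟨b, hb⟩) hab
    · have := @h (.inl a) (.inl b) hab; simp_all
    · have := @h (.inl a) (.inr b) hab; simp_all
    · have := @h (.inr a) (.inl b) hab; simp_all
    · have := @h (.inr a) (.inr b) hab; simp_all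
  sign c := D.sign c

open Classical in
/-- Insert a new plain point on the edge that leaves `p`. -/
noncomputable def subdivide (p : D.Pt) : GaussDiagram where
  Pt := Option D.Pt
  Cr := D.Cr
  finite_pt := by have := D.finite_pt; infer_instance
  next := (Equiv.swap none (some p)).trans (Equiv.optionCongr D.next)
  overPt c := some (D.overPt c)
  underPt c := some (D.underPt c)
  injective := by
    have h := D.injective
    rintro (a | a) (b | b) hab
    · have := @h (.inl a) (.inl b) (by simpa using hab); simp_all
    · have := @h (.inl a) (.inr b) (by simpa using hab); simp_all
    · have := @h (.inr a) (.inl b) (by simpa using hab); simp_all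
    · have := @h (.inr a) (.inr b) (by simpa using hab); simp_all
  sign := D.sign

/-- Move the passages of the crossings along a permutation of the marked points. -/
def permute (π : Equiv.Perm D.Pt) : GaussDiagram where
  Pt := D.Pt
  Cr := D.Cr
  finite_pt := D.finite_pt
  next := D.next
  overPt c := π (D.overPt c)
  underPt c := π (D.underPt c)
  injective := by
    have h : Sum.elim (fun c => π (D.overPt c)) (fun c => π (D.underPt c))
        = π ∘ Sum.elim D.overPt D.underPt := by
      ext x; cases x <;> rfl
    rw [h]
    exact π.injective.comp D.injective
  sign := D.sign

/-- `p` and `q` are consecutive marked points, in this order if `ε = 1` and in the opposite order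
if `ε = -1`. -/
def Consecutive (ε : ℤˣ) (p q : D.Pt) : Prop :=
  (ε = 1 ∧ D.next p = q) ∨ (ε = -1 ∧ D.next q = p)

structure Iso (D D' : GaussDiagram) where
  pt : D.Pt ≃ D'.Pt
  cr : D.Cr ≃ D'.Cr
  next_pt : ∀ p, pt (D.next p) = D'.next (pt p)
  overPt_cr : ∀ c, pt (D.overPt c) = D'.overPt (cr c)
  underPt_cr : ∀ c, pt (D.underPt c) = D'.underPt (cr c)
  sign_cr : ∀ c, D'.sign (cr c) = D.sign c

/-- A triangle bounded by a top strand (over the two others), a middle strand and a bottom strand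
(under the two others); `a` is the crossing of top and middle, `b` of top and bottom, `c` of
middle and bottom. The sign condition says that the three edges bound a common face. -/
def IsTriangle (a b c : D.Cr) : Prop :=
  a ≠ b ∧ b ≠ c ∧ a ≠ c ∧
  ∃ εt εm εb : ℤˣ,
    D.Consecutive εt (D.overPt a) (D.overPt b) ∧
    D.Consecutive εm (D.underPt a) (D.overPt c) ∧
    D.Consecutive εb (D.underPt b) (D.underPt c) ∧
    D.sign a * εt * εm = D.sign b * εt * εb ∧
    D.sign b * εt * εb = D.sign c * εm * εb

open Classical in
/-- Interchange the two passages on each of the three sides of a triangle. -/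
noncomputable def flipTriangle (a b c : D.Cr) : GaussDiagram :=
  D.permute (Equiv.swap (D.overPt a) (D.overPt b) * Equiv.swap (D.underPt a) (D.overPt c) *
    Equiv.swap (D.underPt b) (D.underPt c))

inductive Move : GaussDiagram → GaussDiagram → Prop
  | iso {D D' : GaussDiagram} (e : Iso D D') : Move D D'
  | subdivide (D : GaussDiagram) (p : D.Pt) : Move D (D.subdivide p)
  | reidemeister1 (D : GaussDiagram) (c : D.Cr)
      (h : D.next (D.overPt c) = D.underPt c ∨ D.next (D.underPt c) = D.overPt c) :
      Move D (D.erase {c})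
  | reidemeister2 (D : GaussDiagram) (c d : D.Cr)
      (hs : D.sign d = -D.sign c)
      (ho : D.next (D.overPt c) = D.overPt d)
      (hu : D.next (D.underPt c) = D.underPt d ∨ D.next (D.underPt d) = D.underPt c) :
      Move D (D.erase {c, d})
  | reidemeister3 (D : GaussDiagram) (a b c : D.Cr) (h : D.IsTriangle a b c) :
      Move D (D.flipTriangle a b c)

/-! #### Arcs and components -/

/-- The edges that arrive at `q` and leave `q` lie on the same arc unless `q` is an underpass. -/
def ArcAdj (p q : D.Pt) : Prop := D.next p = q ∧ ∀ c, D.underPt c ≠ q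

def Arc : Type := Quot D.ArcAdj

/-- The components `K₁, …, K_μ` of the link. -/
def Component : Type := Quot fun p q : D.Pt => D.next p = q

/-- The arc that contains the edge leaving `p`. -/
def arcOut (p : D.Pt) : D.Arc := Quot.mk _ p

/-- The arc that contains the edge arriving at `p`. -/
def arcIn (p : D.Pt) : D.Arc := D.arcOut (D.edgeIn p)

/-- The component of an arc. -/
def κ : D.Arc → D.Component :=
  Quot.lift (fun p => Quot.mk _ p) fun _ _ h => Quot.sound h.1

def overArc (c : D.Cr) : D.Arc := D.arcOut (D.overPt c)

/-- The underpassing arc on the right of the overpassing strand. -/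
def rightArc (c : D.Cr) : D.Arc :=
  if D.sign c = 1 then D.arcIn (D.underPt c) else D.arcOut (D.underPt c)

/-- The underpassing arc on the left of the overpassing strand. -/
def leftArc (c : D.Cr) : D.Arc :=
  if D.sign c = 1 then D.arcOut (D.underPt c) else D.arcIn (D.underPt c)

theorem κ_arcIn (p : D.Pt) : D.κ (D.arcIn p) = D.κ (D.arcOut p) :=
  Quot.sound (r := fun p q : D.Pt => D.next p = q) (D.next.apply_symm_apply p)

theorem κ_rightArc (c : D.Cr) : D.κ (D.rightArc c) = D.κ (D.leftArc c) := by
  unfold rightArc leftArc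
  split_ifs <;> simp [κ_arcIn]

end GaussDiagram

/-- A diagram of a classical oriented link. -/
structure LinkDiagram extends GaussDiagram where
  planar : toGaussDiagram.IsPlanar

/-- Two diagrams represent the same oriented link type if they are connected by a finite sequence
of Reidemeister moves and their inverses. -/
def LinkDiagram.Equivalent : LinkDiagram → LinkDiagram → Prop :=
  Relation.EqvGen fun D D' => GaussDiagram.Move D.toGaussDiagram D'.toGaussDiagram

/-! ### Quandles

Mathlib's `y ◃ x` is the element that is usually written `x ▷ y` in knot theory. -/

/-- `Q` and `Q'` are isomorphic quandles. -/
def QuandleIso (Q Q' : Type*) [Quandle Q] [Quandle Q'] : Prop :=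
  ∃ f : Q ≃ Q', ∀ x y, f (x ◃ y) = f x ◃ f y

/-- The subquandle generated by a set. -/
inductive subquandleClosure {Q : Type*} [Quandle Q] (S : Set Q) : Set Q
  | of (x : Q) : x ∈ S → subquandleClosure S x
  | act (x y : Q) : subquandleClosure S x → subquandleClosure S y → subquandleClosure S (y ◃ x)
  | invAct (x y : Q) :
      subquandleClosure S x → subquandleClosure S y → subquandleClosure S (y ◃⁻¹ x)

section UnitQuandle

variable {R M : Type*} [CommRing R] [AddCommGroup M] [Module R M]

/-- The elements `x` for which `φ x + 1` is a unit. -/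
abbrev UnitQuandle (φ : M →ₗ[R] R) : Type _ := {x : M // IsUnit (φ x + 1)}

namespace UnitQuandle

variable {φ : M →ₗ[R] R}

/-- The unit `φ x + 1`. -/
noncomputable def unit (x : UnitQuandle φ) : Rˣ := x.2.unit

theorem coe_unit (x : UnitQuandle φ) : (x.unit : R) = φ x.1 + 1 := x.2.unit_spec

theorem map_act (x y : UnitQuandle φ) : φ ((φ y.1 + 1) • x.1 - φ x.1 • y.1) = φ x.1 := by
  simp only [map_sub, map_smul, smul_eq_mul]; ring

theorem map_invAct (x y : UnitQuandle φ) :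
    φ ((y.unit⁻¹ : Rˣ) • (x.1 + φ x.1 • y.1)) = φ x.1 := by
  have h : φ (x.1 + φ x.1 • y.1) = (y.unit : R) * φ x.1 := by
    simp only [map_add, map_smul, smul_eq_mul, coe_unit]; ring
  rw [Units.smul_def, map_smul, h, smul_eq_mul, Units.inv_mul_cancel_left]

/-- The quandle with `x ▷ y = (φ y + 1) x - φ x y`. -/
noncomputable instance : Quandle (UnitQuandle φ) where
  act y x := ⟨(φ y.1 + 1) • x.1 - φ x.1 • y.1, by rw [map_act]; exact x.2⟩
  invAct y x := ⟨(y.unit⁻¹ : Rˣ) • (x.1 + φ x.1 • y.1), by rw [map_invAct]; exact x.2⟩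
  self_distrib := by
    intro x y z
    apply Subtype.ext
    simp only [map_act]
    module
  left_inv := by
    intro y x
    apply Subtype.ext
    dsimp only
    rw [map_act, ← coe_unit, sub_add_cancel, Units.smul_def, smul_smul, Units.inv_mul, one_smul]
  right_inv := by
    intro y x
    apply Subtype.ext
    simp only [map_invAct, ← coe_unit]
    rw [Units.smul_def, smul_smul, Units.mul_inv, one_smul, add_sub_cancel_right]
  fix := by
    intro x
    apply Subtype.ext
    dsimp only
    module

end UnitQuandle

end UnitQuandle

/-! ### Alexander modules -/

/-- Laurent polynomials over `ℤ` in the variables `t i`, `i : ι`. -/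
abbrev MvLaurent (ι : Type) : Type := AddMonoidAlgebra ℤ (ι →₀ ℤ)

namespace MvLaurent

variable {ι : Type}

/-- The variable `t i`. -/
noncomputable def t (i : ι) : MvLaurent ι := AddMonoidAlgebra.single (Finsupp.single i 1) 1

theorem isUnit_t (i : ι) : IsUnit (t i) := by
  refine IsUnit.of_mul_eq_one (AddMonoidAlgebra.single (Finsupp.single i (-1)) 1) ?_
  rw [t, AddMonoidAlgebra.single_mul_single, ← Finsupp.single_add]
  simp [AddMonoidAlgebra.one_def]

/-- The ring homomorphism that sends every variable `t i` to `t`. -/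
noncomputable def τ (ι : Type) : MvLaurent ι →+* ℤ[T;T⁻¹] :=
  AddMonoidAlgebra.mapDomainRingHom ℤ
    (Finsupp.liftAddHom (fun _ : ι => AddMonoidHom.id ℤ) : (ι →₀ ℤ) →+ ℤ)

theorem τ_t (i : ι) : τ ι (t i) = LaurentPolynomial.T 1 := by
  simp only [τ, t, LaurentPolynomial.T, AddMonoidAlgebra.mapDomainRingHom_apply,
    AddMonoidAlgebra.mapDomain_single]
  simp

noncomputable instance (ι : Type) : Algebra (MvLaurent ι) ℤ[T;T⁻¹] := (τ ι).toAlgebra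

end MvLaurent

namespace GaussDiagram

open MvLaurent

variable (D : GaussDiagram)

/-- The crossing relation `(1 - t_{κ(a₂)}) a₁ + t_{κ(a₁)} a₂ - a₃`, where `a₁` is the overpassing
arc and `a₂`, `a₃` are the underpassing arcs on its right and on its left. -/
noncomputable def ρ (c : D.Cr) : D.Arc →₀ MvLaurent D.Component :=
  Finsupp.single (D.overArc c) (1 - t (D.κ (D.rightArc c)))
    + Finsupp.single (D.rightArc c) (t (D.κ (D.overArc c)))
    - Finsupp.single (D.leftArc c) 1

/-- The multivariate Alexander module `M_A`. -/
abbrev AlexanderModule : Type :=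
  (D.Arc →₀ MvLaurent D.Component) ⧸ Submodule.span (MvLaurent D.Component) (Set.range D.ρ)

/-- The generator of `M_A` that corresponds to an arc. -/
noncomputable def γ (a : D.Arc) : D.AlexanderModule := Submodule.Quotient.mk (Finsupp.single a 1)

/-- The Crowell map, `γ a ↦ t_{κ(a)} - 1`. -/
noncomputable def crowell : D.AlexanderModule →ₗ[MvLaurent D.Component] MvLaurent D.Component :=
  Submodule.liftQ _ (Finsupp.linearCombination _ fun a => t (D.κ a) - 1) <| by
    rw [Submodule.span_le]
    rintro _ ⟨c, rfl⟩
    simp only [ρ, SetLike.mem_coe, LinearMap.mem_ker, map_sub, map_add,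
      Finsupp.linearCombination_single, κ_rightArc, smul_eq_mul]
    ring

theorem crowell_γ (a : D.Arc) : D.crowell (D.γ a) = t (D.κ a) - 1 := by
  simp [crowell, γ]

/-- The generator of an arc as an element of the quandle of all `x` in `M_A` for which
`φ x + 1` is a unit. -/
noncomputable def arcElement (a : D.Arc) : UnitQuandle D.crowell :=
  ⟨D.γ a, by rw [crowell_γ, sub_add_cancel]; exact isUnit_t _⟩

/-- The fundamental multivariate Alexander quandle `Q_A`. -/
def alexanderQuandle : Set (UnitQuandle D.crowell) := subquandleClosure (Set.range D.arcElement)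

/-- The reduced Alexander module `M_A^red`, a module over `ℤ[t, t⁻¹]`. -/
abbrev ReducedAlexanderModule : Type := ℤ[T;T⁻¹] ⊗[MvLaurent D.Component] D.AlexanderModule

/-- The map `x ↦ x ⊗ 1` (with the tensor factors written in the opposite order). -/
noncomputable def reduce (x : D.AlexanderModule) : D.ReducedAlexanderModule := 1 ⊗ₜ x

/-- The set `Q_A^red = {x ⊗ 1 | x ∈ Q_A}`. -/
def reducedSet : Set D.ReducedAlexanderModule :=
  (fun x : UnitQuandle D.crowell => D.reduce x.1) '' D.alexanderQuandle

theorem crowell_act (x y : UnitQuandle D.crowell) :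
    D.crowell (y ◃ x).1 = D.crowell x.1 := UnitQuandle.map_act x y

theorem crowell_invAct (x y : UnitQuandle D.crowell) :
    D.crowell (y ◃⁻¹ x).1 = D.crowell x.1 := UnitQuandle.map_invAct x y

theorem τ_crowell {x : UnitQuandle D.crowell} (hx : x ∈ D.alexanderQuandle) :
    τ _ (D.crowell x.1) = LaurentPolynomial.T 1 - 1 := by
  induction hx with
  | of x h =>
    obtain ⟨a, rfl⟩ := h
    simp [arcElement, crowell_γ, τ_t]
  | act x y _ _ hx _ => rw [crowell_act, hx]
  | invAct x y _ _ hx _ => rw [crowell_invAct, hx]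

theorem reduce_smul (r : MvLaurent D.Component) (x : D.AlexanderModule) :
    D.reduce (r • x) = τ _ r • D.reduce x := by
  rw [reduce, reduce, ← TensorProduct.smul_tmul, TensorProduct.smul_tmul', Algebra.smul_def,
    smul_eq_mul]
  rfl

/-- `(x ▷ y) ⊗ 1 = t (x ⊗ 1) + (1 - t) (y ⊗ 1)` for `x, y` in `Q_A`. -/
theorem reduce_act {x y : UnitQuandle D.crowell} (hx : x ∈ D.alexanderQuandle)
    (hy : y ∈ D.alexanderQuandle) :
    D.reduce (y ◃ x).1 = (LaurentPolynomial.T 1 : ℤ[T;T⁻¹]) • D.reduce x.1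
      + (1 - LaurentPolynomial.T 1 : ℤ[T;T⁻¹]) • D.reduce y.1 := by
  have h : D.reduce (y ◃ x).1
      = D.reduce ((D.crowell y.1 + 1) • x.1) - D.reduce (D.crowell x.1 • y.1) :=
    TensorProduct.tmul_sub _ _ _
  rw [h, reduce_smul, reduce_smul, map_add, map_one, τ_crowell D hx, τ_crowell D hy]
  module

/-- `(x ▷⁻¹ y) ⊗ 1 = t⁻¹ (x ⊗ 1) + (1 - t⁻¹) (y ⊗ 1)` for `x, y` in `Q_A`. -/
theorem reduce_invAct {x y : UnitQuandle D.crowell} (hx : x ∈ D.alexanderQuandle)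
    (hy : y ∈ D.alexanderQuandle) :
    D.reduce (y ◃⁻¹ x).1 = (LaurentPolynomial.T (-1) : ℤ[T;T⁻¹]) • D.reduce x.1
      + (1 - LaurentPolynomial.T (-1) : ℤ[T;T⁻¹]) • D.reduce y.1 := by
  have h := D.reduce_act (subquandleClosure.invAct x y hx hy) hy
  rw [Rack.right_inv] at h
  have hT : (LaurentPolynomial.T (-1) : ℤ[T;T⁻¹]) * LaurentPolynomial.T 1 = 1 := by
    rw [← LaurentPolynomial.T_add]; simp
  rw [h, smul_add, smul_smul, smul_smul, mul_sub, hT]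
  module

/-- The quandle `Q_A^red`. -/
abbrev ReducedQuandle : Type := D.reducedSet

/-- The quandle operations of `Q_A^red` are `(x ⊗ 1) ▷ (y ⊗ 1) = (x ▷ y) ⊗ 1` and
`(x ⊗ 1) ▷⁻¹ (y ⊗ 1) = (x ▷⁻¹ y) ⊗ 1`; see `reduced_act` and `reduced_invAct`. -/
noncomputable instance : Quandle D.ReducedQuandle where
  act y x := ⟨(LaurentPolynomial.T 1 : ℤ[T;T⁻¹]) • x.1
      + (1 - LaurentPolynomial.T 1 : ℤ[T;T⁻¹]) • y.1, by
    obtain ⟨_, x, hx, rfl⟩ := x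
    obtain ⟨_, y, hy, rfl⟩ := y
    exact ⟨y ◃ x, subquandleClosure.act x y hx hy, D.reduce_act hx hy⟩⟩
  invAct y x := ⟨(LaurentPolynomial.T (-1) : ℤ[T;T⁻¹]) • x.1
      + (1 - LaurentPolynomial.T (-1) : ℤ[T;T⁻¹]) • y.1, by
    obtain ⟨_, x, hx, rfl⟩ := x
    obtain ⟨_, y, hy, rfl⟩ := y
    exact ⟨y ◃⁻¹ x, subquandleClosure.invAct x y hx hy, D.reduce_invAct hx hy⟩⟩
  self_distrib := by
    intro x y z
    apply Subtype.ext
    dsimp only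
    module
  left_inv := by
    intro y x
    apply Subtype.ext
    have hT : (LaurentPolynomial.T (-1) : ℤ[T;T⁻¹]) * LaurentPolynomial.T 1 = 1 := by
      rw [← LaurentPolynomial.T_add]; simp
    dsimp only
    rw [smul_add, smul_smul, smul_smul, mul_sub, hT]
    module
  right_inv := by
    intro y x
    apply Subtype.ext
    have hT : (LaurentPolynomial.T 1 : ℤ[T;T⁻¹]) * LaurentPolynomial.T (-1) = 1 := by
      rw [← LaurentPolynomial.T_add]; simp
    dsimp only
    rw [smul_add, smul_smul, smul_smul, mul_sub, hT]
    module
  fix := by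
    intro x
    apply Subtype.ext
    dsimp only
    module

theorem reduced_act {x y : UnitQuandle D.crowell} (hx : x ∈ D.alexanderQuandle)
    (hy : y ∈ D.alexanderQuandle) :
    (⟨D.reduce y.1, y, hy, rfl⟩ ◃ ⟨D.reduce x.1, x, hx, rfl⟩ : D.ReducedQuandle)
      = ⟨D.reduce (y ◃ x).1, y ◃ x, subquandleClosure.act x y hx hy, rfl⟩ :=
  Subtype.ext (D.reduce_act hx hy).symm

theorem reduced_invAct {x y : UnitQuandle D.crowell} (hx : x ∈ D.alexanderQuandle)
    (hy : y ∈ D.alexanderQuandle) :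
    (⟨D.reduce y.1, y, hy, rfl⟩ ◃⁻¹ ⟨D.reduce x.1, x, hx, rfl⟩ : D.ReducedQuandle)
      = ⟨D.reduce (y ◃⁻¹ x).1, y ◃⁻¹ x, subquandleClosure.invAct x y hx hy, rfl⟩ :=
  Subtype.ext (D.reduce_invAct hx hy).symm

end GaussDiagram

/-! ### The two links -/

instance : Fintype Side := ⟨{.left, .right}, by intro x; cases x <;> decide⟩

/-- A count of the classes of a relation by means of a function `f` that is constant on classes
and of a map `g` that moves inside the classes until it reaches a representative. -/
theorem natCard_quot_eq {α : Type} {r : α → α → Prop} {n : ℕ} (f : α → Fin n) (s : Fin n → α)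
    (g : α → α) (hf : ∀ a b, r a b → f a = f b) (hs : ∀ i, f (s i) = i)
    (hg : ∀ a, Quot.mk r a = Quot.mk r (g a)) (m : ℕ) (hm : ∀ a, ∃ k < m, g^[k] a = s (f a)) :
    Nat.card (Quot r) = n := by
  have hk : ∀ k a, Quot.mk r a = Quot.mk r (g^[k] a) := by
    intro k
    induction k with
    | zero => intro a; rfl
    | succ k ih => intro a; rw [Function.iterate_succ_apply, ← ih]; exact hg a
  have e : Quot r ≃ Fin n :=
    { toFun := Quot.lift f hf
      invFun := fun i => Quot.mk r (s i)
      left_inv := by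
        rintro ⟨a⟩
        obtain ⟨k, -, h⟩ := hm a
        change Quot.mk r (s (f a)) = Quot.mk r a
        rw [← h, ← hk]
      right_inv := hs }
  rw [Nat.card_congr e, Nat.card_fin]

namespace GaussDiagram

/-- Two split copies of the Hopf link, with curves `0 → 1`, `2 → 3`, `4 → 5`, `6 → 7` of two
marked points each; all four crossings are negative. -/
def twoHopf : GaussDiagram where
  Pt := Fin 8
  Cr := Fin 4
  finite_pt := inferInstance
  next := ⟨![1, 0, 3, 2, 5, 4, 7, 6], ![1, 0, 3, 2, 5, 4, 7, 6], by decide, by decide⟩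
  overPt := ![1, 2, 5, 6]
  underPt := ![3, 0, 7, 4]
  injective := by decide
  sign _ := -1

/-- A chain of three circles `0 → 1`, `2 → 3 → 4 → 5` and `6 → 7`, in which the middle circle is
linked once with each of the other two, and a split circle `8` without crossings; all four
crossings are positive. -/
def chainAndCircle : GaussDiagram where
  Pt := Fin 9
  Cr := Fin 4
  finite_pt := inferInstance
  next := ⟨![1, 0, 3, 4, 5, 2, 7, 6, 8], ![1, 0, 5, 2, 3, 4, 7, 6, 8], by decide, by decide⟩
  overPt := ![1, 3, 5, 7]
  underPt := ![2, 0, 6, 4]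
  injective := by decide
  sign _ := 1

theorem twoHopf_planar : twoHopf.IsPlanar := by
  have hF : Nat.card twoHopf.Face = 8 := by
    refine natCard_quot_eq (α := Fin 8 × Side)
      (fun x => x.2.rec (![0, 2, 2, 3, 4, 6, 6, 7] x.1) (![1, 3, 0, 1, 5, 7, 4, 5] x.1))
      ![(0, .left), (0, .right), (1, .left), (1, .right), (4, .left), (4, .right), (5, .left), (5, .right)]
      (fun x => x.2.rec
        (![(0, .left), (1, .left), (1, .left), (1, .right), (4, .left), (5, .left), (5, .left), (5, .right)] x.1)
        (![(0, .right), (1, .right), (0, .left), (0, .right), (4, .right), (5, .right), (4, .left), (4, .right)] x.1))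
      ?_ (by decide) ?_ 2 (by decide)
    · have hp : ∀ (p : Fin 8) (s : Side),
          (∀ c : Fin 4, (![1, 2, 5, 6] : Fin 4 → Fin 8) c ≠ p ∧
            (![3, 0, 7, 4] : Fin 4 → Fin 8) c ≠ p) → False := by decide
      rintro _ _ (⟨p, h, s⟩ | ⟨c, h⟩ | ⟨c, h⟩ | ⟨c, h⟩ | ⟨c, h⟩ | ⟨c, h⟩ | ⟨c, h⟩ | ⟨c, h⟩ | ⟨c, h⟩)
      · have := hp p s h
        exact this.elim
      all_goals first
        | exact absurd h (by decide : (-1 : ℤˣ) ≠ 1)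
        | (clear h; revert c; change ∀ c : Fin 4, _; decide)
    · rintro ⟨p, s⟩
      fin_cases p <;> cases s <;> first
        | rfl
        | exact (Quot.sound (SideAdj.neg_top (D := twoHopf) (0 : Fin 4) rfl)).symm
        | exact (Quot.sound (SideAdj.neg_bottom (D := twoHopf) (0 : Fin 4) rfl)).symm
        | exact Quot.sound (SideAdj.neg_east (D := twoHopf) (0 : Fin 4) rfl)
        | exact Quot.sound (SideAdj.neg_west (D := twoHopf) (0 : Fin 4) rfl)
        | exact (Quot.sound (SideAdj.neg_top (D := twoHopf) (2 : Fin 4) rfl)).symm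
        | exact (Quot.sound (SideAdj.neg_bottom (D := twoHopf) (2 : Fin 4) rfl)).symm
        | exact Quot.sound (SideAdj.neg_east (D := twoHopf) (2 : Fin 4) rfl)
        | exact Quot.sound (SideAdj.neg_west (D := twoHopf) (2 : Fin 4) rfl)
  have hP : Nat.card twoHopf.Piece = 2 := by
    refine natCard_quot_eq (α := Fin 8) ![0, 0, 0, 0, 1, 1, 1, 1] ![0, 4] ![0, 0, 0, 2, 4, 4, 4, 6] ?_ (by decide) ?_ 3
      (by decide)
    · rintro p _ (_ | ⟨c⟩)
      · revert p; change ∀ p : Fin 8, _; decide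
      · revert c; change ∀ c : Fin 4, _; decide
    · intro p
      fin_cases p <;> first
        | rfl
        | exact Quot.sound (PieceAdj.crossing (D := twoHopf) (1 : Fin 4))
        | exact (Quot.sound (PieceAdj.edge (D := twoHopf) (0 : Fin 8))).symm
        | exact (Quot.sound (PieceAdj.edge (D := twoHopf) (2 : Fin 8))).symm
        | exact Quot.sound (PieceAdj.crossing (D := twoHopf) (3 : Fin 4))
        | exact (Quot.sound (PieceAdj.edge (D := twoHopf) (4 : Fin 8))).symm
        | exact (Quot.sound (PieceAdj.edge (D := twoHopf) (6 : Fin 8))).symm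
  have hC : Nat.card twoHopf.Cr = 4 := Nat.card_fin 4
  rw [IsPlanar, hF, hP, hC]

theorem chainAndCircle_planar : chainAndCircle.IsPlanar := by
  have hF : Nat.card chainAndCircle.Face = 8 := by
    refine natCard_quot_eq (α := Fin 9 × Side)
      (fun x => x.2.rec (![0, 2, 0, 1, 4, 1, 4, 5, 6] x.1) (![1, 3, 2, 3, 5, 3, 1, 3, 7] x.1))
      ![(0, .left), (0, .right), (1, .left), (1, .right), (4, .left), (4, .right), (8, .left), (8, .right)]
      (fun x => x.2.rec
        (![(0, .left), (1, .left), (0, .left), (6, .right), (4, .left), (0, .right), (4, .left), (4, .right), (8, .left)] x.1)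
        (![(0, .right), (1, .right), (1, .left), (1, .right), (4, .right), (1, .right), (5, .left), (3, .right), (8, .right)] x.1))
      ?_ (by decide) ?_ 4 (by decide)
    · have hp : ∀ (p : Fin 9) (s : Side),
          (∀ c : Fin 4, (![1, 3, 5, 7] : Fin 4 → Fin 9) c ≠ p ∧
            (![2, 0, 6, 4] : Fin 4 → Fin 9) c ≠ p) → p = 8 := by decide
      rintro _ _ (⟨p, h, s⟩ | ⟨c, h⟩ | ⟨c, h⟩ | ⟨c, h⟩ | ⟨c, h⟩ | ⟨c, h⟩ | ⟨c, h⟩ | ⟨c, h⟩ | ⟨c, h⟩)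
      · have := hp p s h
        subst this; rfl
      all_goals first
        | exact absurd h (by decide : (1 : ℤˣ) ≠ -1)
        | (clear h; revert c; change ∀ c : Fin 4, _; decide)
    · rintro ⟨p, s⟩
      fin_cases p <;> cases s <;> first
        | rfl
        | exact (Quot.sound (SideAdj.pos_top (D := chainAndCircle) (0 : Fin 4) rfl)).symm
        | exact (Quot.sound (SideAdj.pos_bottom (D := chainAndCircle) (0 : Fin 4) rfl)).symm
        | exact Quot.sound (SideAdj.pos_west (D := chainAndCircle) (0 : Fin 4) rfl)
        | exact (Quot.sound (SideAdj.pos_east (D := chainAndCircle) (1 : Fin 4) rfl)).symm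
        | exact (Quot.sound (SideAdj.pos_top (D := chainAndCircle) (2 : Fin 4) rfl)).symm
        | exact (Quot.sound (SideAdj.pos_bottom (D := chainAndCircle) (2 : Fin 4) rfl)).symm
        | exact Quot.sound (SideAdj.pos_west (D := chainAndCircle) (2 : Fin 4) rfl)
        | exact (Quot.sound (SideAdj.pos_bottom (D := chainAndCircle) (3 : Fin 4) rfl)).symm
        | exact (Quot.sound (SideAdj.pos_east (D := chainAndCircle) (3 : Fin 4) rfl)).symm
        | exact Quot.sound (SideAdj.pos_east (D := chainAndCircle) (0 : Fin 4) rfl)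
  have hP : Nat.card chainAndCircle.Piece = 2 := by
    refine natCard_quot_eq (α := Fin 9) ![0, 0, 0, 0, 0, 0, 0, 0, 1] ![0, 8] ![0, 0, 1, 2, 3, 4, 7, 4, 8] ?_ (by decide) ?_ 7
      (by decide)
    · rintro p _ (_ | ⟨c⟩)
      · revert p; change ∀ p : Fin 9, _; decide
      · revert c; change ∀ c : Fin 4, _; decide
    · intro p
      fin_cases p <;> first
        | rfl
        | exact (Quot.sound (PieceAdj.edge (D := chainAndCircle) (0 : Fin 9))).symm
        | exact (Quot.sound (PieceAdj.crossing (D := chainAndCircle) (0 : Fin 4))).symm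
        | exact (Quot.sound (PieceAdj.edge (D := chainAndCircle) (2 : Fin 9))).symm
        | exact (Quot.sound (PieceAdj.edge (D := chainAndCircle) (3 : Fin 9))).symm
        | exact (Quot.sound (PieceAdj.edge (D := chainAndCircle) (4 : Fin 9))).symm
        | exact Quot.sound (PieceAdj.crossing (D := chainAndCircle) (3 : Fin 4))
        | exact (Quot.sound (PieceAdj.edge (D := chainAndCircle) (7 : Fin 9))).symm
  have hC : Nat.card chainAndCircle.Cr = 4 := Nat.card_fin 4
  rw [IsPlanar, hF, hP, hC]

end GaussDiagram

/-- The split union of two Hopf links. -/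
def LinkDiagram.twoHopf : LinkDiagram := ⟨GaussDiagram.twoHopf, GaussDiagram.twoHopf_planar⟩

/-- The split union of a chain of three circles and a circle. -/
def LinkDiagram.chainAndCircle : LinkDiagram :=
  ⟨GaussDiagram.chainAndCircle, GaussDiagram.chainAndCircle_planar⟩

/-! ### Iterated Alexander operations in a module -/

/-! A linear map from the reduced Alexander module to a $\Lambda$-module $N$ is the same as a
coloring of the diagram by the Alexander quandle $N$ (`exists_lift`, `hom_ext`), and $Q_A^{red}$ is
the closure of the generators `gen p` under both operations `slide` (`reducedSet_subset`,
`slideClosed_reducedSet`). The proof works with colorings in place of presentations.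

Invariance: each Reidemeister move recolors diagrams bijectively, naturally in $N$ and by quandle
operations only. Applied to the universal colorings, this gives a linear isomorphism that matches
the quandles inside the modules (`sameReduced_of_transforms`), hence both claims at once. The three
moves rest on idempotence, invertibility and self-distributivity of `slide`.

The quandle determines the module: a quandle morphism restricted to generators is a coloring, so it
extends linearly. The extensions of an isomorphism and of its inverse are mutually inverse
(`nonempty_linearEquiv_of_quandleIso`).

The converse fails: $x\triangleright y=x$ means $(1-t)x=(1-t)y$ (`slide_eq_self_iff`), and this is
all that a Hopf clasp imposes. Both modules are therefore $\Lambda^2\oplus(\Lambda/(1-t))^2$. The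
three circles of the chain give distinct generators $x,y,z$ for which $y$ acts trivially on $x$ and
$z$. For two Hopf links this is impossible: modulo $1-t$ the quandle meets only the classes of the
four components, two of them for each free coordinate vector, and a class together with $(1-t)x$
determines $x$ (`twoHopf_eq_of_act_eq`). -/

section Slide

variable {N : Type*} [AddCommGroup N] [Module ℤ[T;T⁻¹] N]

/-- The element `x ▷ y` if `s = 1`, and `x ▷⁻¹ y` if `s = -1`, of the Alexander quandle `N`. -/
noncomputable def slide (s : ℤˣ) (y x : N) : N :=
  (LaurentPolynomial.T (s : ℤ) : ℤ[T;T⁻¹]) • x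
    + (1 - LaurentPolynomial.T (s : ℤ) : ℤ[T;T⁻¹]) • y

theorem T_mul_T_neg (n : ℤ) :
    (LaurentPolynomial.T n : ℤ[T;T⁻¹]) * LaurentPolynomial.T (-n) = 1 := by
  rw [← LaurentPolynomial.T_add]; simp

theorem slide_self (s : ℤˣ) (x : N) : slide s x x = x := by
  unfold slide; module

theorem slide_slide_neg (s : ℤˣ) (y x : N) : slide s y (slide (-s) y x) = x := by
  have h := T_mul_T_neg (s : ℤ)
  unfold slide
  rw [Units.val_neg, smul_add, smul_smul, smul_smul, mul_sub, h]
  module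

theorem slide_neg_slide (s : ℤˣ) (y x : N) : slide (-s) y (slide s y x) = x := by
  simpa using slide_slide_neg (-s) y x

/-- The action of `z` is affine over $\Lambda$ and `slide s` is an affine combination, so the two
signs may be independent; the third Reidemeister move needs this. -/
theorem slide_distrib (s r : ℤˣ) (z y x : N) :
    slide s (slide r z y) (slide r z x) = slide r z (slide s y x) := by
  unfold slide; module

theorem slide_eq_iff (s : ℤˣ) (x y z : N) : z = slide s y x ↔ x = slide (-s) y z := by
  constructor
  · rintro rfl; rw [slide_neg_slide]
  · rintro rfl; rw [slide_slide_neg]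

theorem slide_injective (s : ℤˣ) (y : N) : Function.Injective (slide s y) := fun a b h => by
  rw [← slide_neg_slide s y a, h, slide_neg_slide]

theorem map_slide {N' : Type*} [AddCommGroup N'] [Module ℤ[T;T⁻¹] N'] (h : N →ₗ[ℤ[T;T⁻¹]] N')
    (s : ℤˣ) (y x : N) : h (slide s y x) = slide s (h y) (h x) := by
  simp [slide]

/-- A set closed under both operations of the Alexander quandle `N`. -/
def SlideClosed (S : Set N) : Prop := ∀ s, ∀ x ∈ S, ∀ y ∈ S, slide s y x ∈ S

end Slide

/-! ### Colorings and the universal property of the reduced Alexander module -/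

/-- A coloring of the edges of the diagram with permutation `nx` and with crossings given by `o`,
`u` and `s`: the color changes only at underpasses, where the overpassing color acts on it. -/
structure IsColoring {P C N : Type*} [AddCommGroup N] [Module ℤ[T;T⁻¹] N]
    (nx : Equiv.Perm P) (o u : C → P) (s : C → ℤˣ) (f : P → N) : Prop where
  const : ∀ p, (∀ c, u c ≠ p) → f p = f (nx.symm p)
  cross : ∀ c, f (u c) = slide (s c) (f (o c)) (f (nx.symm (u c)))

namespace GaussDiagram

variable (D : GaussDiagram)

/-- An arc coloring, read on edges. -/
def Coloring {N : Type*} [AddCommGroup N] [Module ℤ[T;T⁻¹] N] (f : D.Pt → N) : Prop :=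
  IsColoring D.next D.overPt D.underPt D.sign f

/-- The generator of the reduced Alexander module given by the edge leaving `p`. -/
noncomputable def gen (p : D.Pt) : D.ReducedAlexanderModule := D.reduce (D.γ (D.arcOut p))

variable {D}

theorem gen_mem (p : D.Pt) : D.gen p ∈ D.reducedSet :=
  ⟨D.arcElement (D.arcOut p), subquandleClosure.of _ ⟨_, rfl⟩, rfl⟩

theorem slideClosed_reducedSet : SlideClosed D.reducedSet := by
  intro s x hx y hy
  obtain rfl | rfl := Int.units_eq_one_or s
  · exact ((⟨y, hy⟩ : D.ReducedQuandle) ◃ ⟨x, hx⟩).2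
  · exact ((⟨y, hy⟩ : D.ReducedQuandle) ◃⁻¹ ⟨x, hx⟩).2

/-- Induction principle for $Q_A^{red}$. On $Q_A$ every Crowell value reduces to $t-1$, so `reduce`
turns the multivariate operations into `slide`. -/
theorem reducedSet_subset {S : Set D.ReducedAlexanderModule} (hS : SlideClosed S)
    (hg : ∀ p, D.gen p ∈ S) : D.reducedSet ⊆ S := by
  rintro _ ⟨x, hx, rfl⟩
  change D.reduce x.1 ∈ S
  induction hx with
  | of x h =>
    obtain ⟨⟨p⟩, rfl⟩ := h
    exact hg p
  | act x y hx hy hxS hyS =>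
    rw [D.reduce_act hx hy]
    exact hS 1 _ hxS _ hyS
  | invAct x y hx hy hxS hyS =>
    rw [D.reduce_invAct hx hy]
    exact hS (-1) _ hxS _ hyS

theorem reduce_ρ (c : D.Cr) :
    D.reduce (D.γ (D.leftArc c)) =
      slide 1 (D.reduce (D.γ (D.overArc c))) (D.reduce (D.γ (D.rightArc c))) := by
  have h : (Submodule.Quotient.mk (D.ρ c) : D.AlexanderModule) = 0 :=
    (Submodule.Quotient.mk_eq_zero _).2 (Submodule.subset_span ⟨c, rfl⟩)
  have h' : (Submodule.Quotient.mk (D.ρ c) : D.AlexanderModule) =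
      (1 - MvLaurent.t (D.κ (D.rightArc c))) • D.γ (D.overArc c)
        + MvLaurent.t (D.κ (D.overArc c)) • D.γ (D.rightArc c) - D.γ (D.leftArc c) := by
    rw [γ, γ, γ, ← Submodule.Quotient.mk_smul, ← Submodule.Quotient.mk_smul,
      ← Submodule.Quotient.mk_add, ← Submodule.Quotient.mk_sub]
    simp [ρ]
  rw [h', sub_eq_zero] at h
  rw [← h]
  have hadd : ∀ x y : D.AlexanderModule, D.reduce (x + y) = D.reduce x + D.reduce y :=
    fun x y => TensorProduct.tmul_add _ _ _
  rw [hadd, reduce_smul, reduce_smul, map_sub, map_one, MvLaurent.τ_t, MvLaurent.τ_t, slide,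
    add_comm]
  simp

/-- Relations speak of right and left arcs, colorings of incoming and outgoing edges. At a negative
crossing right is outgoing, and solving the relation for it inverts the operation. -/
theorem coloring_iff {N : Type*} [AddCommGroup N] [Module ℤ[T;T⁻¹] N] (f : D.Arc → N) :
    D.Coloring (fun p => f (D.arcOut p)) ↔
      ∀ c, f (D.leftArc c) = slide 1 (f (D.overArc c)) (f (D.rightArc c)) := by
  have key : ∀ c, f (D.leftArc c) = slide 1 (f (D.overArc c)) (f (D.rightArc c)) ↔
      f (D.arcOut (D.underPt c)) = slide (D.sign c) (f (D.arcOut (D.overPt c)))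
        (f (D.arcOut (D.next.symm (D.underPt c)))) := by
    intro c
    obtain h | h := Int.units_eq_one_or (D.sign c)
    · simp only [leftArc, rightArc, h, if_true]; rfl
    · simp only [leftArc, rightArc, h, show (-1 : ℤˣ) ≠ 1 by decide, if_false]
      rw [slide_eq_iff]; rfl
  constructor
  · intro h c
    exact (key c).2 (h.cross c)
  · intro h
    refine ⟨fun p hp => ?_, fun c => (key c).1 (h c)⟩
    exact congrArg f (Quot.sound ⟨D.next.apply_symm_apply p, hp⟩).symm

theorem coloring_gen : D.Coloring D.gen :=
  (coloring_iff fun a => D.reduce (D.γ a)).2 reduce_ρ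

theorem hom_ext {N : Type*} [AddCommGroup N] [Module ℤ[T;T⁻¹] N]
    {F G : D.ReducedAlexanderModule →ₗ[ℤ[T;T⁻¹]] N} (h : ∀ p, F (D.gen p) = G (D.gen p)) :
    F = G := by
  have key : ∀ x : D.AlexanderModule, F (D.reduce x) = G (D.reduce x) := by
    intro x
    obtain ⟨x, rfl⟩ := Submodule.Quotient.mk_surjective _ x
    induction x using Finsupp.induction_linear with
    | zero => simp [reduce]
    | add x y hx hy =>
      have : ∀ x y : D.AlexanderModule, D.reduce (x + y) = D.reduce x + D.reduce y :=
        fun x y => TensorProduct.tmul_add _ _ _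
      rw [Submodule.Quotient.mk_add, this, map_add, map_add, hx, hy]
    | single a r =>
      obtain ⟨p⟩ := a
      have : (Submodule.Quotient.mk (Finsupp.single (D.arcOut p) r) : D.AlexanderModule)
          = r • D.γ (D.arcOut p) := by
        rw [γ, ← Submodule.Quotient.mk_smul]; simp
      change F (D.reduce (Submodule.Quotient.mk (Finsupp.single (D.arcOut p) r))) =
        G (D.reduce (Submodule.Quotient.mk (Finsupp.single (D.arcOut p) r)))
      rw [this, reduce_smul, map_smul, map_smul]
      exact congrArg _ (h p)
  refine LinearMap.ext fun x => ?_
  induction x using TensorProduct.induction_on with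
  | zero => simp
  | add x y hx hy => rw [map_add, map_add, hx, hy]
  | tmul r x =>
    have : r ⊗ₜ[MvLaurent D.Component] x = r • D.reduce x := by
      rw [reduce, TensorProduct.smul_tmul', smul_eq_mul, mul_one]
    rw [this, map_smul, map_smul, key]

/-- Universal property: a coloring kills the crossing relations once every $t_i$ acts as $t$, and
extension of scalars does the rest. -/
theorem exists_lift {N : Type*} [AddCommGroup N] [Module ℤ[T;T⁻¹] N] {f : D.Pt → N}
    (hf : D.Coloring f) :
    ∃ F : D.ReducedAlexanderModule →ₗ[ℤ[T;T⁻¹]] N, ∀ p, F (D.gen p) = f p := by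
  obtain ⟨f, rfl⟩ : ∃ f' : D.Arc → N, f = fun p => f' (D.arcOut p) :=
    ⟨Quot.lift f fun p q h => by
      rw [hf.const q h.2, ← h.1, Equiv.symm_apply_apply], rfl⟩
  -- Restricting scalars along `τ` makes `N` a target for maps from the multivariate module.
  let _ : Module (MvLaurent D.Component) N := Module.compHom N (MvLaurent.τ D.Component)
  have hsmul : ∀ (r : MvLaurent D.Component) (x : N), r • x = MvLaurent.τ _ r • x :=
    fun _ _ => rfl
  have : IsScalarTower (MvLaurent D.Component) ℤ[T;T⁻¹] N := ⟨fun r s x => by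
    rw [hsmul, Algebra.smul_def, mul_smul]; rfl⟩
  have hker : Submodule.span (MvLaurent D.Component) (Set.range D.ρ) ≤
      LinearMap.ker (Finsupp.linearCombination (MvLaurent D.Component) f) := by
    rw [Submodule.span_le]
    rintro _ ⟨c, rfl⟩
    have := (coloring_iff f).1 hf c
    simp only [ρ, SetLike.mem_coe, LinearMap.mem_ker, map_sub, map_add,
      Finsupp.linearCombination_single, hsmul, MvLaurent.τ_t, map_one]
    rw [this, slide, Units.val_one]
    module
  refine ⟨LinearMap.liftBaseChange ℤ[T;T⁻¹] (Submodule.liftQ _ _ hker), fun p => ?_⟩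
  simp [gen, reduce, γ]

variable (D) in
/-- The linear map on the reduced Alexander module induced by a coloring. -/
noncomputable def lift {N : Type*} [AddCommGroup N] [Module ℤ[T;T⁻¹] N] (f : D.Pt → N)
    (hf : D.Coloring f) : D.ReducedAlexanderModule →ₗ[ℤ[T;T⁻¹]] N := (exists_lift hf).choose

@[simp]
theorem lift_gen {N : Type*} [AddCommGroup N] [Module ℤ[T;T⁻¹] N] {f : D.Pt → N}
    (hf : D.Coloring f) (p : D.Pt) : D.lift f hf (D.gen p) = f p :=
  (exists_lift hf).choose_spec p

/-! ### The quandle determines the module -/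

theorem nonempty_linearEquiv_of_quandleIso {D D' : GaussDiagram}
    (h : QuandleIso D.ReducedQuandle D'.ReducedQuandle) :
    Nonempty (D.ReducedAlexanderModule ≃ₗ[ℤ[T;T⁻¹]] D'.ReducedAlexanderModule) := by
  have key : ∀ (D D' : GaussDiagram) (f : D.ReducedQuandle → D'.ReducedQuandle),
      (∀ x y, f (x ◃ y) = f x ◃ f y) →
      ∃ F : D.ReducedAlexanderModule →ₗ[ℤ[T;T⁻¹]] D'.ReducedAlexanderModule,
        ∀ x, F x.1 = (f x).1 := by
    intro D D' f hf
    -- Preservation of `◃` alone suffices: the action of `f x` can be cancelled.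
    have hinv : ∀ x y, f (x ◃⁻¹ y) = f x ◃⁻¹ f y := fun x y => by
      rw [← Rack.left_cancel (f x), ← hf, Rack.right_inv, Rack.right_inv]
    have hslide : ∀ s (x y : D.ReducedQuandle), (f ⟨slide s y.1 x.1,
        slideClosed_reducedSet s _ x.2 _ y.2⟩).1 = slide s (f y).1 (f x).1 := by
      intro s x y
      obtain rfl | rfl := Int.units_eq_one_or s
      · exact congrArg Subtype.val (hf y x)
      · exact congrArg Subtype.val (hinv y x)
    have hc : D.Coloring fun p => (f ⟨D.gen p, gen_mem p⟩).1 := by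
      refine ⟨fun p hp => ?_, fun c => ?_⟩
      · have := coloring_gen.const p hp
        simp only [this]
      · have := coloring_gen.cross c
        rw [← hslide]
        simp only [this]
    refine ⟨D.lift _ hc, fun x => ?_⟩
    -- The linear map and `f` agree on generators, and the set where they agree is closed under
    -- `slide`.
    have : D.reducedSet ⊆ {x | ∃ h : x ∈ D.reducedSet, D.lift _ hc x = (f ⟨x, h⟩).1} := by
      refine reducedSet_subset ?_ fun p => ⟨gen_mem p, lift_gen hc p⟩
      rintro s x ⟨hx, hx'⟩ y ⟨hy, hy'⟩
      exact ⟨slideClosed_reducedSet s _ hx _ hy, by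
        rw [map_slide, hx', hy']; exact (hslide s ⟨x, hx⟩ ⟨y, hy⟩).symm⟩
    exact (this x.2).2
  obtain ⟨f, hf⟩ := h
  obtain ⟨F, hF⟩ := key D D' f hf
  obtain ⟨G, hG⟩ := key D' D f.symm fun x y => by
    rw [Equiv.symm_apply_eq, hf, Equiv.apply_symm_apply, Equiv.apply_symm_apply]
  refine ⟨LinearEquiv.ofLinearMap F G (hom_ext fun p => ?_) (hom_ext fun p => ?_)⟩
  · simp [hG ⟨_, gen_mem p⟩, hF]
  · simp [hF ⟨_, gen_mem p⟩, hG]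

/-! ### Natural transformations of colorings -/

/-- A linear isomorphism of reduced Alexander modules that matches the quandles in them. -/
def SameReduced (D D' : GaussDiagram) : Prop :=
  ∃ e : D.ReducedAlexanderModule ≃ₗ[ℤ[T;T⁻¹]] D'.ReducedAlexanderModule,
    ∀ x, e x ∈ D'.reducedSet ↔ x ∈ D.reducedSet

theorem SameReduced.refl (D : GaussDiagram) : SameReduced D D :=
  ⟨LinearEquiv.refl _ _, fun _ => Iff.rfl⟩

theorem SameReduced.symm {D D' : GaussDiagram} (h : SameReduced D D') : SameReduced D' D := by
  obtain ⟨e, he⟩ := h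
  exact ⟨e.symm, fun x => by rw [← he, LinearEquiv.apply_symm_apply]⟩

theorem SameReduced.trans {D D' D'' : GaussDiagram} (h : SameReduced D D')
    (h' : SameReduced D' D'') : SameReduced D D'' := by
  obtain ⟨e, he⟩ := h
  obtain ⟨e', he'⟩ := h'
  exact ⟨e.trans e', fun x => by rw [LinearEquiv.trans_apply, he', he]⟩

theorem SameReduced.quandleIso {D D' : GaussDiagram} (h : SameReduced D D') :
    QuandleIso D.ReducedQuandle D'.ReducedQuandle := by
  obtain ⟨e, he⟩ := h
  exact ⟨e.toEquiv.subtypeEquiv fun x => (he x).symm, fun x y =>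
    Subtype.ext (map_slide e.toLinearMap 1 x.1 y.1)⟩

/-- A way to turn colorings of `D` into colorings of `D'` that is natural in the module of
colors. -/
structure ColoringTransform (D D' : GaussDiagram) where
  map : ∀ {N : Type} [AddCommGroup N] [Module ℤ[T;T⁻¹] N], (D.Pt → N) → D'.Pt → N
  coloring : ∀ {N : Type} [AddCommGroup N] [Module ℤ[T;T⁻¹] N] {f : D.Pt → N},
    D.Coloring f → D'.Coloring (map f)
  natural : ∀ {N N' : Type} [AddCommGroup N] [Module ℤ[T;T⁻¹] N] [AddCommGroup N']
    [Module ℤ[T;T⁻¹] N'] (h : N →ₗ[ℤ[T;T⁻¹]] N') (f : D.Pt → N) (p : D'.Pt),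
    h (map f p) = map (fun q => h (f q)) p
  mem : ∀ {N : Type} [AddCommGroup N] [Module ℤ[T;T⁻¹] N] {S : Set N} {f : D.Pt → N},
    SlideClosed S → (∀ p, f p ∈ S) → ∀ p, map f p ∈ S

/-- A Yoneda argument: `Ψ` applied to the universal coloring of `D'` is a coloring of `D`, hence a
linear map from the module of `D` to that of `D'`; `Φ` gives the inverse, and `mem` keeps colors
inside the quandles. -/
theorem sameReduced_of_transforms {D D' : GaussDiagram} (Φ : ColoringTransform D D')
    (Ψ : ColoringTransform D' D)
    (h : ∀ {N : Type} [AddCommGroup N] [Module ℤ[T;T⁻¹] N] {f : D.Pt → N}, D.Coloring f →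
      ∀ p, Ψ.map (Φ.map f) p = f p)
    (h' : ∀ {N : Type} [AddCommGroup N] [Module ℤ[T;T⁻¹] N] {f : D'.Pt → N}, D'.Coloring f →
      ∀ p, Φ.map (Ψ.map f) p = f p) : SameReduced D D' := by
  have mem : ∀ {D D' : GaussDiagram} (Ψ : ColoringTransform D' D) (x : D.ReducedAlexanderModule),
      x ∈ D.reducedSet → D.lift _ (Ψ.coloring D'.coloring_gen) x ∈ D'.reducedSet := by
    intro D D' Ψ x hx
    refine reducedSet_subset (S := {x | D.lift _ (Ψ.coloring D'.coloring_gen) x ∈ D'.reducedSet})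
      ?_ ?_ hx
    · intro s x hx y hy
      rw [Set.mem_ofPred_eq, map_slide]
      exact slideClosed_reducedSet s _ hx _ hy
    · intro p
      rw [Set.mem_ofPred_eq, lift_gen]
      exact Ψ.mem slideClosed_reducedSet gen_mem p
  have inv : ∀ {D D' : GaussDiagram} (Φ : ColoringTransform D D') (Ψ : ColoringTransform D' D),
      (∀ {N : Type} [AddCommGroup N] [Module ℤ[T;T⁻¹] N] {f : D.Pt → N}, D.Coloring f →
        ∀ p, Ψ.map (Φ.map f) p = f p) →
      D'.lift _ (Φ.coloring D.coloring_gen) ∘ₗ D.lift _ (Ψ.coloring D'.coloring_gen)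
        = LinearMap.id := by
    intro D D' Φ Ψ h
    refine hom_ext fun p => ?_
    -- Naturality moves the outer map inside `Ψ`, where it turns `D'.gen` into `Φ.map D.gen`.
    rw [LinearMap.comp_apply, lift_gen, Ψ.natural]
    simp only [lift_gen]
    exact h D.coloring_gen p
  refine ⟨LinearEquiv.ofLinearMap _ _ (inv Ψ Φ h') (inv Φ Ψ h), fun x => ⟨fun hx => ?_, mem Ψ x⟩⟩
  have := mem Φ _ hx
  rwa [LinearEquiv.coe_ofLinearMap, ← LinearMap.comp_apply, inv Φ Ψ h] at this

end GaussDiagram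

/-! ### Colorings along a strand travelled in either direction -/

section Arrive

variable {P C N : Type*} [AddCommGroup N] [Module ℤ[T;T⁻¹] N] {nx : Equiv.Perm P} {o u : C → P}
  {s : C → ℤˣ} {f : P → N}

/-- The edge by which one arrives at `p` when travelling along the orientation if `ε = 1`, and
against it if `ε = -1`. Hence `arrive nx (-ε) p` is the edge by which one leaves. -/
def arrive (nx : Equiv.Perm P) (ε : ℤˣ) (p : P) : P := if ε = 1 then nx.symm p else p

theorem arrive_one (p : P) : arrive nx 1 p = nx.symm p := rfl

theorem arrive_neg_one (p : P) : arrive nx (-1) p = p := rfl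

/-- An edge has only two ends, each with a determined direction of arrival. -/
theorem eq_or_eq_of_arrive_eq {p q r : P} {ε δ : ℤˣ} (h : arrive nx (-ε) p = arrive nx ε q)
    (hr : arrive nx δ r = arrive nx (-ε) p) : r = p ∧ δ = -ε ∨ r = q ∧ δ = ε := by
  obtain rfl | rfl := Int.units_eq_one_or ε <;> obtain rfl | rfl := Int.units_eq_one_or δ <;>
    simp_all [arrive_one, arrive_neg_one, Equiv.symm_apply_eq, Equiv.eq_symm_apply]

theorem IsColoring.const_arrive (hf : IsColoring nx o u s f) {p : P} (hp : ∀ c, u c ≠ p)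
    (ε δ : ℤˣ) : f (arrive nx ε p) = f (arrive nx δ p) := by
  have := hf.const p hp
  obtain rfl | rfl := Int.units_eq_one_or ε <;> obtain rfl | rfl := Int.units_eq_one_or δ <;>
    simp [arrive_one, arrive_neg_one, this]

/-- Travelling against the orientation inverts the operation, whence the factor `ε`. -/
theorem cross_iff_arrive (c : C) (ε : ℤˣ) (y : N) :
    f (u c) = slide (s c) y (f (nx.symm (u c))) ↔
      f (arrive nx (-ε) (u c)) = slide (s c * ε) y (f (arrive nx ε (u c))) := by
  obtain rfl | rfl := Int.units_eq_one_or ε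
  · simp [arrive_one, arrive_neg_one]
  · simp only [neg_neg, arrive_one, arrive_neg_one, mul_neg, mul_one]
    exact slide_eq_iff _ _ _ _

theorem IsColoring.cross_arrive (hf : IsColoring nx o u s f) (c : C) (ε : ℤˣ) :
    f (arrive nx (-ε) (u c)) = slide (s c * ε) (f (o c)) (f (arrive nx ε (u c))) :=
  (cross_iff_arrive c ε _).1 (hf.cross c)

end Arrive

/-! ### The third Reidemeister move on colorings -/

/-- The diagrams `(o, u)` and `(o', u')` differ by moving a bottom strand across the crossing `a`
of a top strand and a middle strand; `b` is the crossing of top and bottom, `c` of middle and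
bottom, and the strands are travelled such that `a` precedes `b` on the top strand, `a` precedes
`c` on the middle strand and `b` precedes `c` on the bottom strand of the first diagram. -/
structure TriangleFlip {P C : Type*} (nx : Equiv.Perm P) (s : C → ℤˣ) (o u o' u' : C → P)
    (a b c : C) (εt εm εb : ℤˣ) : Prop where
  o_ne_u : ∀ i j, o i ≠ u j
  u_inj : ∀ i j, u i = u j → i = j
  o_inj : ∀ i j, o i = o j → i = j
  o'_ne_u' : ∀ i j, o' i ≠ u' j
  u'_inj : ∀ i j, u' i = u' j → i = j
  o'_inj : ∀ i j, o' i = o' j → i = j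
  hab : a ≠ b
  hbc : b ≠ c
  hac : a ≠ c
  top : arrive nx (-εt) (o a) = arrive nx εt (o b)
  mid : arrive nx (-εm) (u a) = arrive nx εm (o c)
  bot : arrive nx (-εb) (u b) = arrive nx εb (u c)
  sign : s a * εm = s b * εb
  o'_a : o' a = o b
  o'_b : o' b = o a
  o'_c : o' c = u a
  u'_a : u' a = o c
  u'_b : u' b = u c
  u'_c : u' c = u b
  o'_of_ne : ∀ i, i ≠ a → i ≠ b → i ≠ c → o' i = o i
  u'_of_ne : ∀ i, i ≠ a → i ≠ b → i ≠ c → u' i = u i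

section FlipColor

variable {P C N : Type*} [AddCommGroup N] [Module ℤ[T;T⁻¹] N] {nx : Equiv.Perm P}
  {s : C → ℤˣ} {o u o' u' : C → P} {a b c : C} {εt εm εb : ℤˣ} {f : P → N}

open Classical in
/-- The coloring after a triangle move. -/
noncomputable def flipColor (nx : Equiv.Perm P) (s : C → ℤˣ) (u : C → P) (a b c : C) (εm εb : ℤˣ)
    (f : P → N) (p : P) : N :=
  if p = arrive nx (-εm) (u a) then f (arrive nx εm (u a))
  else if p = arrive nx (-εb) (u b) then
    slide (s c * εb) (f (arrive nx εm (u a))) (f (arrive nx εb (u b)))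
  else f p

theorem flipColor_mid (f : P → N) :
    flipColor nx s u a b c εm εb f (arrive nx (-εm) (u a)) = f (arrive nx εm (u a)) := by
  simp [flipColor]

namespace TriangleFlip

/-- The moved triangle is again a triangle, with every strand travelled the other way. -/
theorem symm (h : TriangleFlip nx s o u o' u' a b c εt εm εb) :
    TriangleFlip nx s o' u' o u a b c (-εt) (-εm) (-εb) := by
  obtain ⟨h1, h2, h3, h1', h2', h3', hab, hbc, hac, ht, hm, hb, hs, e1, e2, e3, e4, e5, e6, e7,
    e8⟩ := h
  refine ⟨h1', h2', h3', h1, h2, h3, hab, hbc, hac, ?_, ?_, ?_, ?_, e2.symm, e1.symm, e4.symm,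
    e3.symm, e6.symm, e5.symm, fun i h h' h'' => (e7 i h h' h'').symm, fun i h h' h'' => (e8 i h h' h'').symm⟩
  · rw [e1, e2, ht, neg_neg]
  · rw [e3, e4, hm, neg_neg]
  · rw [e5, e6, hb, neg_neg]
  · rw [mul_neg, hs, mul_neg]

variable (h : TriangleFlip nx s o u o' u' a b c εt εm εb)
include h

theorem mid_ne_bot : arrive nx (-εb) (u b) ≠ arrive nx (-εm) (u a) := fun e => by
  obtain ⟨e, -⟩ | ⟨e, -⟩ := eq_or_eq_of_arrive_eq h.mid e
  · exact h.hab (h.u_inj _ _ e).symm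
  · exact h.o_ne_u _ _ e.symm

theorem flipColor_bot (f : P → N) :
    flipColor nx s u a b c εm εb f (arrive nx (-εb) (u b)) =
      slide (s c * εb) (f (arrive nx εm (u a))) (f (arrive nx εb (u b))) := by
  simp [flipColor, h.mid_ne_bot]

/-- Only the middle and the bottom side are recolored; their ends are `u a`, `o c` and `u b`, `u c`.
The hypotheses say that an edge at such an end points out of the triangle. -/
theorem flipColor_arrive (f : P → N) {r : P} {δ : ℤˣ} (ha : r = u a → δ = εm)
    (hc : r = o c → δ = -εm) (hb : r = u b → δ = εb) (hc' : r = u c → δ = -εb) :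
    flipColor nx s u a b c εm εb f (arrive nx δ r) = f (arrive nx δ r) := by
  have hne : ∀ ε : ℤˣ, ε ≠ -ε := by decide
  rw [flipColor, if_neg, if_neg]
  · intro e
    obtain ⟨e, e'⟩ | ⟨e, e'⟩ := eq_or_eq_of_arrive_eq h.bot e
    · exact hne _ ((hb e).symm.trans e')
    · exact hne _ (e'.symm.trans (hc' e))
  · intro e
    obtain ⟨e, e'⟩ | ⟨e, e'⟩ := eq_or_eq_of_arrive_eq h.mid e
    · exact hne _ ((ha e).symm.trans e')
    · exact hne _ (e'.symm.trans (hc e))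

theorem flipColor_over (f : P → N) {i : C} (hi : i ≠ c) :
    flipColor nx s u a b c εm εb f (o i) = f (o i) := by
  have := h.flipColor_arrive f (r := o i) (δ := -1) (fun e => (h.o_ne_u _ _ e).elim)
    (fun e => (hi (h.o_inj _ _ e)).elim) (fun e => (h.o_ne_u _ _ e).elim)
    (fun e => (h.o_ne_u _ _ e).elim)
  rwa [arrive_neg_one] at this

/-- After the move `u a` is the overpass of `c`, so the color must not change there. -/
theorem flipColor_under (f : P → N) (δ : ℤˣ) :
    flipColor nx s u a b c εm εb f (arrive nx δ (u a)) = f (arrive nx εm (u a)) := by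
  have : δ = εm ∨ δ = -εm := by clear h; revert δ εm; decide
  obtain rfl | rfl := this
  · refine h.flipColor_arrive f (fun _ => rfl) (fun e => (h.o_ne_u _ _ e.symm).elim)
      (fun e => (h.hab (h.u_inj _ _ e)).elim) (fun e => (h.hac (h.u_inj _ _ e)).elim)
  · exact flipColor_mid f

theorem color_top (hf : IsColoring nx o u s f) : f (o a) = f (o b) := by
  have ho : ∀ i j, u j ≠ o i := fun i j e => h.o_ne_u i j e.symm
  have e1 := hf.const_arrive (ho a) (-1) (-εt)
  have e2 := hf.const_arrive (ho b) (-1) εt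
  rw [h.top, ← e2] at e1
  exact e1

theorem color_mid (hf : IsColoring nx o u s f) :
    f (arrive nx (-εm) (u a)) = f (o c) := by
  rw [h.mid]
  exact hf.const_arrive (fun j e => h.o_ne_u c j e.symm) εm (-1)

/-- After the move the middle strand meets the bottom strand before it passes under the top, so its
side carries the color it enters with; the bottom side carries the result of passing under that
color. Only the exit of the bottom strand needs an argument, and there the two orders of passing
agree by self-distributivity. -/
theorem isColoring_flipColor (hf : IsColoring nx o u s f) :
    IsColoring nx o' u' s (flipColor nx s u a b c εm εb f) := by
  have ht := h.color_top hf
  have hm := h.color_mid hf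
  have ho : ∀ i j, u j ≠ o i := fun i j e => h.o_ne_u i j e.symm
  refine ⟨fun p hp => ?_, fun d => ?_⟩
  · by_cases hpa : p = u a
    · subst hpa
      exact (h.flipColor_under f (-1)).trans (h.flipColor_under f 1).symm
    · have hc : p ≠ o c := fun e => hp a (h.u'_a.trans e.symm)
      have hb : p ≠ u b := fun e => hp c (h.u'_c.trans e.symm)
      have hc' : p ≠ u c := fun e => hp b (h.u'_b.trans e.symm)
      have hu : ∀ i, u i ≠ p := by
        intro i e
        by_cases h1 : i = a
        · subst h1; exact hpa e.symm
        by_cases h2 : i = b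
        · subst h2; exact hb e.symm
        by_cases h3 : i = c
        · subst h3; exact hc' e.symm
        exact hp i ((h.u'_of_ne i h1 h2 h3).trans e)
      have key : ∀ δ, flipColor nx s u a b c εm εb f (arrive nx δ p) = f (arrive nx δ p) :=
        fun δ => h.flipColor_arrive f (fun e => (hpa e).elim) (fun e => (hc e).elim)
          (fun e => (hb e).elim) (fun e => (hc' e).elim)
      have k1 := key 1
      have k2 := key (-1)
      rw [arrive_one] at k1
      rw [arrive_neg_one] at k2
      rw [k1, k2, hf.const p hu]
  by_cases hda : d = a
  · subst hda
    rw [cross_iff_arrive d εm, h.u'_a, h.o'_a, ← h.mid, flipColor_mid,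
      h.flipColor_over f h.hbc, h.flipColor_arrive f (fun e => (ho _ _ e.symm).elim) (fun _ => rfl)
      (fun e => (ho _ _ e.symm).elim) (fun e => (ho _ _ e.symm).elim), ← ht, ← hf.cross_arrive, hm]
    exact hf.const_arrive (ho c) _ (-1)
  -- Here `slide_distrib` enters; `h.sign` says that the top strand acts on the middle and the
  -- bottom strand by the same operation.
  by_cases hdb : d = b
  · subst hdb
    rw [cross_iff_arrive d εb, h.u'_b, h.o'_b, ← h.bot, h.flipColor_bot,
      h.flipColor_over f h.hac, h.flipColor_arrive f (fun e => (h.hac (h.u_inj _ _ e).symm).elim)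
      (fun e => (ho _ _ e).elim) (fun e => (h.hbc (h.u_inj _ _ e).symm).elim) (fun _ => rfl),
      hf.cross_arrive, ← h.bot, hf.cross_arrive, ← hm, hf.cross_arrive, h.sign, ht, slide_distrib]
  by_cases hdc : d = c
  · subst hdc
    rw [cross_iff_arrive d εb, h.u'_c, h.o'_c, h.flipColor_bot,
      show u a = arrive nx (-1) (u a) from rfl, h.flipColor_under, arrive_neg_one,
      h.flipColor_arrive f (fun e => (h.hab (h.u_inj _ _ e).symm).elim)
      (fun e => (ho _ _ e).elim) (fun _ => rfl) (fun e => (h.hbc (h.u_inj _ _ e)).elim)]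
  · have key : ∀ δ, flipColor nx s u a b c εm εb f (arrive nx δ (u d)) = f (arrive nx δ (u d)) :=
      fun δ => h.flipColor_arrive f (fun e => (hda (h.u_inj _ _ e)).elim)
        (fun e => (ho _ _ e).elim) (fun e => (hdb (h.u_inj _ _ e)).elim)
        (fun e => (hdc (h.u_inj _ _ e)).elim)
    rw [h.u'_of_ne d hda hdb hdc, h.o'_of_ne d hda hdb hdc, h.flipColor_over f hdc]
    have k1 := key 1
    have k2 := key (-1)
    rw [arrive_one] at k1
    rw [arrive_neg_one] at k2
    rw [k1, k2, hf.cross d]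

/-- The inverse move recolors the same two sides: the middle one regains the color of `o c`, and on
the bottom one opposite operations cancel. -/
theorem flipColor_flipColor (hf : IsColoring nx o u s f) (p : P) :
    flipColor nx s u' a b c (-εm) (-εb) (flipColor nx s u a b c εm εb f) p = f p := by
  have hm := h.color_mid hf
  have ho : ∀ i j, u j ≠ o i := fun i j e => h.o_ne_u i j e.symm
  have h1 : arrive nx (-(-εm)) (u' a) = arrive nx (-εm) (u a) := by rw [neg_neg, h.u'_a, h.mid]
  have h2 : arrive nx (-(-εb)) (u' b) = arrive nx (-εb) (u b) := by rw [neg_neg, h.u'_b, h.bot]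
  have h3 : flipColor nx s u a b c εm εb f (arrive nx (-εm) (u' a)) = f (o c) := by
    rw [h.u'_a, h.flipColor_arrive f (fun e => (ho _ _ e.symm).elim) (fun _ => rfl)
      (fun e => (ho _ _ e.symm).elim) (fun e => (ho _ _ e.symm).elim)]
    exact hf.const_arrive (ho c) _ (-1)
  have h4 : flipColor nx s u a b c εm εb f (arrive nx (-εb) (u' b)) =
      slide (s c * εb) (f (o c)) (f (arrive nx (-εb) (u b))) := by
    rw [h.u'_b, h.flipColor_arrive f (fun e => (h.hac (h.u_inj _ _ e).symm).elim)
      (fun e => (ho _ _ e).elim) (fun e => (h.hbc (h.u_inj _ _ e).symm).elim) (fun _ => rfl),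
      hf.cross_arrive, ← h.bot]
  conv_lhs => rw [flipColor]
  rw [h1, h2, h3, h4]
  split_ifs with e e'
  · rw [e, hm]
  · rw [mul_neg, slide_neg_slide, e']
  · rw [flipColor, if_neg e, if_neg e']

end TriangleFlip

theorem map_flipColor {N' : Type*} [AddCommGroup N'] [Module ℤ[T;T⁻¹] N']
    (g : N →ₗ[ℤ[T;T⁻¹]] N') (f : P → N) (p : P) :
    g (flipColor nx s u a b c εm εb f p) = flipColor nx s u a b c εm εb (fun q => g (f q)) p := by
  unfold flipColor
  split_ifs <;> simp [map_slide]

theorem flipColor_mem {S : Set N} (hS : SlideClosed S) (hf : ∀ p, f p ∈ S) (p : P) :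
    flipColor nx s u a b c εm εb f p ∈ S := by
  unfold flipColor
  split_ifs
  exacts [hf _, hS _ _ (hf _) _ (hf _), hf _]

end FlipColor

/-! ### The triangle move on diagrams -/

namespace GaussDiagram

theorem overPt_ne_underPt (D : GaussDiagram) (i j : D.Cr) : D.overPt i ≠ D.underPt j := fun e => by
  simpa using @D.injective (.inl i) (.inr j) e

theorem overPt_injective (D : GaussDiagram) : Function.Injective D.overPt := fun i j e => by
  simpa using @D.injective (.inl i) (.inl j) e

theorem underPt_injective (D : GaussDiagram) : Function.Injective D.underPt := fun i j e => by
  simpa using @D.injective (.inr i) (.inr j) e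

theorem Consecutive.arrive_eq {D : GaussDiagram} {ε : ℤˣ} {p q : D.Pt}
    (h : D.Consecutive ε p q) : arrive D.next (-ε) p = arrive D.next ε q := by
  obtain ⟨rfl, rfl⟩ | ⟨rfl, rfl⟩ := h
  · simp [arrive_one, arrive_neg_one]
  · simp [arrive_one, arrive_neg_one]

theorem IsTriangle.exists_triangleFlip {D : GaussDiagram} {a b c : D.Cr}
    (h : D.IsTriangle a b c) : ∃ εt εm εb, TriangleFlip D.next D.sign D.overPt D.underPt
      (D.flipTriangle a b c).overPt (D.flipTriangle a b c).underPt a b c εt εm εb := by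
  classical
  obtain ⟨hab, hbc, hac, εt, εm, εb, ht, hm, hb, hs, -⟩ := h
  have ou := D.overPt_ne_underPt
  have oi := D.overPt_injective
  have ui := D.underPt_injective
  have hO : ∀ i, (D.flipTriangle a b c).overPt i = Equiv.swap (D.overPt a) (D.overPt b)
      (Equiv.swap (D.underPt a) (D.overPt c)
        (Equiv.swap (D.underPt b) (D.underPt c) (D.overPt i))) := fun i => by
    simp [flipTriangle, permute]
  have hU : ∀ i, (D.flipTriangle a b c).underPt i = Equiv.swap (D.overPt a) (D.overPt b)
      (Equiv.swap (D.underPt a) (D.overPt c)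
        (Equiv.swap (D.underPt b) (D.underPt c) (D.underPt i))) := fun i => by
    simp [flipTriangle, permute]
  -- The factor `εt` cancels from the first sign equation of the triangle.
  have sgn : D.sign a * εm = D.sign b * εb := by
    rw [mul_right_comm, mul_right_comm (D.sign b)] at hs
    exact mul_right_cancel hs
  have ou' := (D.flipTriangle a b c).overPt_ne_underPt
  have oi' := (D.flipTriangle a b c).overPt_injective
  have ui' := (D.flipTriangle a b c).underPt_injective
  refine ⟨εt, εm, εb, ou, fun i j e => ui e, fun i j e => oi e, ou', fun i j e => ui' e,
    fun i j e => oi' e, hab, hbc, hac, ht.arrive_eq,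
    hm.arrive_eq, hb.arrive_eq, sgn, ?_, ?_, ?_, ?_, ?_, ?_, fun i h1 h2 h3 => ?_,
    fun i h1 h2 h3 => ?_⟩ <;>
    first
      | refine (hO _).trans ?_
      | refine (hU _).trans ?_
  -- The passages involved are distinct marked points, so the three transpositions are evaluated by
  -- cases.
  all_goals
    simp only [Equiv.swap_apply_def]
    grind [Function.Injective]

theorem sameReduced_reidemeister3 (D : GaussDiagram) (a b c : D.Cr) (h : D.IsTriangle a b c) :
    SameReduced D (D.flipTriangle a b c) := by
  obtain ⟨εt, εm, εb, h⟩ := h.exists_triangleFlip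
  refine sameReduced_of_transforms
    ⟨fun f => flipColor D.next D.sign D.underPt a b c εm εb f, fun hf => h.isColoring_flipColor hf,
      fun g f p => map_flipColor g f p, fun hS hf p => flipColor_mem hS hf p⟩
    ⟨fun f => flipColor D.next D.sign (D.flipTriangle a b c).underPt a b c (-εm) (-εb) f,
      fun hf => h.symm.isColoring_flipColor hf,
      fun g f p => map_flipColor g f p, fun hS hf p => flipColor_mem hS hf p⟩
    (fun hf p => h.flipColor_flipColor hf p) (fun hf p => ?_)
  have := h.symm.flipColor_flipColor hf p
  rwa [neg_neg, neg_neg] at this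

/-! ### The other moves -/

theorem sameReduced_iso {D D' : GaussDiagram} (e : Iso D D') : SameReduced D D' := by
  have hsymm : ∀ p, e.pt.symm (D'.next.symm p) = D.next.symm (e.pt.symm p) := fun p => by
    rw [Equiv.symm_apply_eq, Equiv.symm_apply_eq, ← e.next_pt, Equiv.apply_symm_apply,
      Equiv.apply_symm_apply]
  have hsymm' : ∀ p, e.pt (D.next.symm p) = D'.next.symm (e.pt p) := fun p => by
    rw [Equiv.eq_symm_apply, ← e.next_pt, Equiv.apply_symm_apply]
  refine sameReduced_of_transforms
    ⟨fun f p => f (e.pt.symm p), fun hf => ⟨fun p hp => ?_, fun c => ?_⟩, fun _ _ _ => rfl,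
      fun _ hf _ => hf _⟩
    ⟨fun f p => f (e.pt p), fun hf => ⟨fun p hp => ?_, fun c => ?_⟩, fun _ _ _ => rfl,
      fun _ hf _ => hf _⟩ (fun hf p => ?_) (fun hf p => ?_)
  · rw [hsymm]
    refine hf.const _ fun c hc => hp (e.cr c) ?_
    rw [← e.underPt_cr, hc, Equiv.apply_symm_apply]
  · obtain ⟨c, rfl⟩ := e.cr.surjective c
    rw [hsymm, ← e.underPt_cr, ← e.overPt_cr, Equiv.symm_apply_apply, Equiv.symm_apply_apply,
      e.sign_cr]
    exact hf.cross c
  · rw [hsymm']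
    refine hf.const _ fun c hc => ?_
    obtain ⟨c, rfl⟩ := e.cr.surjective c
    rw [← e.underPt_cr] at hc
    exact hp c (e.pt.injective hc)
  · rw [hsymm', e.underPt_cr, e.overPt_cr, ← e.sign_cr]
    exact hf.cross _
  · simp
  · simp

end GaussDiagram

namespace GaussDiagram

/-! ### Subdividing an edge -/

section Subdivide

variable (D : GaussDiagram) (p : D.Pt)

/-- The predecessor changes only for the point after `p`, where it becomes `none`, of the same color
as `some p`. -/
theorem subdivide_next_symm {N : Type*} {f : Option D.Pt → N} (hf : f none = f (some p))
    (q : D.Pt) : f ((D.subdivide p).next.symm (some q : Option D.Pt)) = f (some (D.next.symm q)) := by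
  classical
  by_cases h : D.next.symm q = p
  · have : (D.subdivide p).next (none : Option D.Pt) = (some q : Option D.Pt) := by
      subst h
      change ((Equiv.swap none (some (D.next.symm q))).trans (Equiv.optionCongr D.next) :
        Equiv.Perm (Option D.Pt)) none = some q
      simp
    rw [h, ← hf]
    exact congrArg f ((D.subdivide p).next.symm_apply_eq.2 this.symm)
  · have : (D.subdivide p).next (some (D.next.symm q) : Option D.Pt) = (some q : Option D.Pt) := by
      change ((Equiv.swap none (some p)).trans (Equiv.optionCongr D.next) :
        Equiv.Perm (Option D.Pt)) (some (D.next.symm q)) = some q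
      simp [Equiv.swap_apply_def, h]
    exact congrArg f ((D.subdivide p).next.symm_apply_eq.2 this.symm)

theorem subdivide_next_symm_none :
    (D.subdivide p).next.symm (none : Option D.Pt) = (some p : Option D.Pt) := by
  classical
  have : (D.subdivide p).next (some p : Option D.Pt) = (none : Option D.Pt) := by
    change ((Equiv.swap none (some p)).trans (Equiv.optionCongr D.next) :
      Equiv.Perm (Option D.Pt)) (some p) = none
    simp
  exact (D.subdivide p).next.symm_apply_eq.2 this.symm

theorem subdivide_coloring_iff {N : Type*} [AddCommGroup N] [Module ℤ[T;T⁻¹] N]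
    (f : Option D.Pt → N) :
    (D.subdivide p).Coloring f ↔ f none = f (some p) ∧ D.Coloring fun q => f (some q) := by
  have hp := D.subdivide_next_symm_none p
  constructor
  · intro hf
    have h : f none = f (some p) :=
      (hf.const none fun c => Option.some_ne_none _).trans (congrArg f hp)
    refine ⟨h, fun q hq => ?_, fun c => ?_⟩
    · exact (hf.const (some q) fun c hc => hq c (Option.some_injective _ hc)).trans
        (D.subdivide_next_symm p h q)
    · exact (hf.cross c).trans (congrArg _ (D.subdivide_next_symm p h _))
  · rintro ⟨h, hf⟩
    refine ⟨?_, fun c => ?_⟩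
    · rintro (_ | q) hq
      · exact h.trans (congrArg f hp.symm)
      · exact (hf.const q fun c hc => hq c (congrArg some hc)).trans
          (D.subdivide_next_symm p h q).symm
    · exact (hf.cross c).trans (congrArg _ (D.subdivide_next_symm p h _).symm)

theorem sameReduced_subdivide : SameReduced D (D.subdivide p) := by
  refine sameReduced_of_transforms
    ⟨fun f (q : Option D.Pt) => f (q.getD p),
      fun {N} _ _ f hf => (D.subdivide_coloring_iff p _).2 ⟨rfl, hf⟩,
      fun _ _ _ => rfl, fun _ hf _ => hf _⟩
    ⟨fun f q => f (some q : Option D.Pt),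
      fun {N} _ _ f hf => ((D.subdivide_coloring_iff p f).1 hf).2,
      fun _ _ _ => rfl, fun _ hf _ => hf _⟩ (fun _ _ => rfl) (fun {N} _ _ f hf q => ?_)
  obtain _ | q := q
  · exact ((D.subdivide_coloring_iff p f).1 hf).1.symm
  · rfl

end Subdivide

/-! ### Erasing crossings and the first Reidemeister move -/

theorem erase_coloring_iff (D : GaussDiagram) (S : Set D.Cr) {N : Type*} [AddCommGroup N]
    [Module ℤ[T;T⁻¹] N] (f : D.Pt → N) :
    (D.erase S).Coloring f ↔
      (∀ p, (∀ c ∉ S, D.underPt c ≠ p) → f p = f (D.next.symm p)) ∧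
      ∀ c ∉ S, f (D.underPt c) = slide (D.sign c) (f (D.overPt c))
        (f (D.next.symm (D.underPt c))) :=
  ⟨fun h => ⟨fun p hp => h.const p fun c => hp c.1 c.2, fun c hc => h.cross ⟨c, hc⟩⟩,
    fun h => ⟨fun p hp => h.1 p fun c hc => hp ⟨c, hc⟩, fun c => h.2 c.1 c.2⟩⟩

theorem Coloring.overPt {D : GaussDiagram} {N : Type*} [AddCommGroup N] [Module ℤ[T;T⁻¹] N]
    {f : D.Pt → N} (hf : D.Coloring f) (c : D.Cr) :
    f (D.overPt c) = f (D.next.symm (D.overPt c)) :=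
  hf.const _ fun d e => D.overPt_ne_underPt c d e.symm

/-- At a kink the overpassing color equals one of the two underpassing colors. By idempotence and
cancellation the crossing condition then says that these two are equal, which is the condition at a
plain point. -/
theorem erase_singleton_coloring_iff (D : GaussDiagram) (c : D.Cr)
    (h : D.next (D.overPt c) = D.underPt c ∨ D.next (D.underPt c) = D.overPt c)
    {N : Type*} [AddCommGroup N] [Module ℤ[T;T⁻¹] N] (f : D.Pt → N) :
    (D.erase {c}).Coloring f ↔ D.Coloring f := by
  have hcolor : f (D.overPt c) = f (D.next.symm (D.overPt c)) →
      (f (D.overPt c) = f (D.next.symm (D.underPt c)) ∨ f (D.overPt c) = f (D.underPt c)) := by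
    intro ho
    obtain h | h := h
    · left; rw [← h, Equiv.symm_apply_apply]
    · right; rw [ho, ← h, Equiv.symm_apply_apply]
  have hiff : f (D.overPt c) = f (D.next.symm (D.overPt c)) →
      (f (D.underPt c) = slide (D.sign c) (f (D.overPt c)) (f (D.next.symm (D.underPt c))) ↔
        f (D.underPt c) = f (D.next.symm (D.underPt c))) := by
    intro ho
    obtain e | e := hcolor ho
    · rw [e, slide_self]
    · rw [e]
      exact ⟨fun h => slide_injective _ _ ((slide_self _ _).trans h),
        fun h => by rw [← h, slide_self]⟩
  rw [erase_coloring_iff]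
  constructor
  · rintro ⟨h1, h2⟩
    have ho := h1 (D.overPt c) fun d _ e => D.overPt_ne_underPt c d e.symm
    refine ⟨fun p hp => h1 p fun d _ => hp d, fun d => ?_⟩
    by_cases hd : d = c
    · subst hd
      exact (hiff ho).2 (h1 _ fun e he h => he (D.underPt_injective h))
    · exact h2 d hd
  · intro hf
    refine ⟨fun p hp => ?_, fun d _ => hf.cross d⟩
    by_cases hpc : D.underPt c = p
    · subst hpc
      exact (hiff (hf.overPt c)).1 (hf.cross c)
    · refine hf.const p fun d => ?_
      by_cases hd : d = c
      · subst hd; exact hpc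
      · exact hp d hd

theorem sameReduced_reidemeister1 (D : GaussDiagram) (c : D.Cr)
    (h : D.next (D.overPt c) = D.underPt c ∨ D.next (D.underPt c) = D.overPt c) :
    SameReduced D (D.erase {c}) :=
  sameReduced_of_transforms
    ⟨fun f => f, fun hf => (D.erase_singleton_coloring_iff c h _).2 hf,
      fun _ _ _ => rfl, fun _ hf _ => hf _⟩
    ⟨fun f => f, fun hf => (D.erase_singleton_coloring_iff c h _).1 hf,
      fun _ _ _ => rfl, fun _ hf _ => hf _⟩ (fun _ _ => rfl) (fun _ _ => rfl)

/-! ### The second Reidemeister move -/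

section Bigon

variable {D : GaussDiagram} {c d : D.Cr} {N : Type*} {f : D.Pt → N}

variable (D) in
/-- Two crossings of opposite signs that bound a bigon, where `c` precedes `d` on the lower
strand. -/
structure IsBigon (c d : D.Cr) : Prop where
  sign : D.sign d = -D.sign c
  overs : D.next (D.overPt c) = D.overPt d ∨ D.next (D.overPt d) = D.overPt c
  unders : D.next (D.underPt c) = D.underPt d

variable (D) in
open Classical in
/-- Give the middle edge of the lower strand the color `x`. -/
noncomputable def recolor (c : D.Cr) (x : N) (f : D.Pt → N) : D.Pt → N :=
  Function.update f (D.underPt c) x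

theorem IsBigon.ne (h : D.IsBigon c d) : d ≠ c := fun e => by
  have h := h.sign
  rw [e] at h
  generalize D.sign c = s at h
  revert s
  decide

theorem IsBigon.symm_under (h : D.IsBigon c d) : D.next.symm (D.underPt d) = D.underPt c := by
  rw [← h.unders, Equiv.symm_apply_apply]

theorem recolor_under (x : N) : D.recolor c x f (D.underPt c) = x := by
  simp [recolor]

theorem recolor_of_ne {x : N} {p : D.Pt} (hp : p ≠ D.underPt c) : D.recolor c x f p = f p := by
  simp [recolor, hp]

theorem recolor_over (x : N) (i : D.Cr) : D.recolor c x f (D.overPt i) = f (D.overPt i) :=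
  recolor_of_ne (D.overPt_ne_underPt _ _)

theorem IsBigon.recolor_symm (h : D.IsBigon c d) (x : N) {p : D.Pt} (hp : p ≠ D.underPt d) :
    D.recolor c x f (D.next.symm p) = f (D.next.symm p) :=
  recolor_of_ne fun e => hp (by rw [← h.unders, ← e, Equiv.apply_symm_apply])

theorem IsBigon.recolor_symm_under (h : D.IsBigon c d) (x : N) :
    D.recolor c x f (D.next.symm (D.underPt c)) = f (D.next.symm (D.underPt c)) :=
  h.recolor_symm x fun e => h.ne (D.underPt_injective e).symm

theorem IsBigon.over_eq (h : D.IsBigon c d)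
    (hf : ∀ i, f (D.overPt i) = f (D.next.symm (D.overPt i))) :
    f (D.overPt d) = f (D.overPt c) := by
  obtain h | h := h.overs
  · rw [hf d, ← h, Equiv.symm_apply_apply]
  · rw [hf c, ← h, Equiv.symm_apply_apply]

theorem recolor_recolor (x y : N) : D.recolor c x (D.recolor c y f) = D.recolor c x f := by
  simp [recolor]

theorem recolor_self (x : N) (hx : x = f (D.underPt c)) : D.recolor c x f = f := by
  simp [recolor, hx]

theorem recolor_mem {S : Set N} {x : N} (hx : x ∈ S) (hf : ∀ p, f p ∈ S) (p : D.Pt) :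
    D.recolor c x f p ∈ S := by
  by_cases hp : p = D.underPt c
  · subst hp; rwa [recolor_under]
  · rw [recolor_of_ne hp]; exact hf p

variable [AddCommGroup N] [Module ℤ[T;T⁻¹] N]

/-- Both overpasses have the same color and the signs are opposite, so the two actions cancel and
the lower strand leaves the bigon as it entered. Its middle edge must then take the entering color.
-/
theorem IsBigon.coloring_erase (h : D.IsBigon c d) (hf : D.Coloring f) :
    (D.erase {c, d}).Coloring (D.recolor c (f (D.next.symm (D.underPt c))) f) := by
  rw [erase_coloring_iff]
  refine ⟨fun p hp => ?_, fun i hi => ?_⟩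
  · by_cases hpc : p = D.underPt c
    · subst hpc
      rw [recolor_under, h.recolor_symm_under]
    by_cases hpd : p = D.underPt d
    · subst hpd
      rw [recolor_of_ne hpc, h.symm_under, recolor_under, hf.cross d, h.symm_under, hf.cross c,
        h.sign, h.over_eq hf.overPt, slide_neg_slide]
    · rw [recolor_of_ne hpc, h.recolor_symm _ hpd]
      refine hf.const p fun i => ?_
      by_cases hic : i = c
      · subst hic; exact Ne.symm hpc
      by_cases hid : i = d
      · subst hid; exact Ne.symm hpd
      · exact hp i (by simp [hic, hid])
  · simp only [Set.mem_insert_iff, Set.mem_singleton_iff, not_or] at hi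
    rw [recolor_of_ne fun e => hi.1 (D.underPt_injective e), recolor_over,
      h.recolor_symm _ fun e => hi.2 (D.underPt_injective e)]
    exact hf.cross i

/-- The crossing `c` forces the color of the middle edge; the crossing `d` then holds by
cancellation. -/
theorem IsBigon.coloring_of_erase (h : D.IsBigon c d) (hf : (D.erase {c, d}).Coloring f) :
    D.Coloring (D.recolor c (slide (D.sign c) (f (D.overPt c)) (f (D.next.symm (D.underPt c)))) f) := by
  rw [erase_coloring_iff] at hf
  obtain ⟨h1, h2⟩ := hf
  have mem : ∀ i : D.Cr, i ∉ ({c, d} : Set D.Cr) ↔ i ≠ c ∧ i ≠ d := by simp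
  have ho : ∀ i, f (D.overPt i) = f (D.next.symm (D.overPt i)) := fun i =>
    h1 _ fun d _ e => D.overPt_ne_underPt i d e.symm
  have hc := h1 (D.underPt c) fun i hi e => ((mem i).1 hi).1 (D.underPt_injective e)
  have hd := h1 (D.underPt d) fun i hi e => ((mem i).1 hi).2 (D.underPt_injective e)
  rw [h.symm_under] at hd
  refine ⟨fun p hp => ?_, fun i => ?_⟩
  · rw [recolor_of_ne (hp c).symm, h.recolor_symm _ (hp d).symm]
    exact h1 p fun i _ => hp i
  · by_cases hic : i = c
    · subst hic
      rw [recolor_under, recolor_over, h.recolor_symm_under]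
    rw [recolor_of_ne fun e => hic (D.underPt_injective e), recolor_over]
    by_cases hid : i = d
    · subst hid
      rw [h.symm_under, recolor_under, h.sign, h.over_eq ho, slide_neg_slide, hd, hc]
    · rw [h.recolor_symm _ fun e => hid (D.underPt_injective e)]
      exact h2 i ((mem i).2 ⟨hic, hid⟩)

theorem map_recolor {N' : Type*} [AddCommGroup N'] [Module ℤ[T;T⁻¹] N']
    (g : N →ₗ[ℤ[T;T⁻¹]] N') (x : N) (p : D.Pt) :
    g (D.recolor c x f p) = D.recolor c (g x) (fun q => g (f q)) p := by
  by_cases hp : p = D.underPt c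
  · subst hp; rw [recolor_under, recolor_under]
  · rw [recolor_of_ne hp, recolor_of_ne hp]

theorem IsBigon.recolor_erase (h : D.IsBigon c d) (hf : D.Coloring f) (y : N) :
    D.recolor c (slide (D.sign c) (D.recolor c y f (D.overPt c))
      (D.recolor c y f (D.next.symm (D.underPt c)))) (D.recolor c y f) = f := by
  rw [recolor_recolor, recolor_over, h.recolor_symm_under]
  exact recolor_self _ (hf.cross c).symm

theorem IsBigon.recolor_of_erase (h : D.IsBigon c d) (hf : (D.erase {c, d}).Coloring f) (y : N) :
    D.recolor c (D.recolor c y f (D.next.symm (D.underPt c))) (D.recolor c y f) = f := by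
  rw [recolor_recolor, h.recolor_symm_under]
  refine recolor_self _
    (((D.erase_coloring_iff _ f).1 hf).1 (D.underPt c) fun i hi e => hi ?_).symm
  rw [D.underPt_injective e]
  exact Set.mem_insert _ _

theorem IsBigon.sameReduced (h : D.IsBigon c d) : SameReduced D (D.erase {c, d}) :=
  sameReduced_of_transforms
    ⟨fun (f : D.Pt → _) => D.recolor c (f (D.next.symm (D.underPt c))) f,
      fun hf => h.coloring_erase hf, fun g f p => map_recolor (D := D) g _ p,
      fun hS hf p => recolor_mem (D := D) (hf _) hf p⟩
    ⟨fun (f : D.Pt → _) =>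
      D.recolor c (slide (D.sign c) (f (D.overPt c)) (f (D.next.symm (D.underPt c)))) f,
      fun hf => h.coloring_of_erase hf,
      fun g f p => (map_recolor (D := D) g _ p).trans (by rw [map_slide]; rfl),
      fun hS hf p => recolor_mem (D := D) (hS _ _ (hf _) _ (hf _)) hf p⟩
    (fun hf p => congrFun (h.recolor_erase hf _) p)
    (fun hf p => congrFun (h.recolor_of_erase hf _) p)

end Bigon

theorem sameReduced_reidemeister2 (D : GaussDiagram) (c d : D.Cr) (hs : D.sign d = -D.sign c)
    (ho : D.next (D.overPt c) = D.overPt d)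
    (hu : D.next (D.underPt c) = D.underPt d ∨ D.next (D.underPt d) = D.underPt c) :
    SameReduced D (D.erase {c, d}) := by
  obtain hu | hu := hu
  · exact IsBigon.sameReduced ⟨hs, .inl ho, hu⟩
  -- With the lower strand running from `d` to `c`, the crossings exchange roles; for this `IsBigon`
  -- admits both orders on the upper strand.
  · rw [Set.pair_comm]
    exact IsBigon.sameReduced ⟨by rw [hs, neg_neg], .inr ho, hu⟩

/-! ### Invariance under all moves -/

theorem Move.sameReduced {D D' : GaussDiagram} (h : Move D D') : SameReduced D D' := by
  cases h with
  | iso e => exact sameReduced_iso e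
  | subdivide p => exact sameReduced_subdivide D p
  | reidemeister1 c h => exact sameReduced_reidemeister1 D c h
  | reidemeister2 c d hs ho hu => exact sameReduced_reidemeister2 D c d hs ho hu
  | reidemeister3 a b c h => exact sameReduced_reidemeister3 D a b c h

end GaussDiagram

theorem LinkDiagram.Equivalent.sameReduced {L L' : LinkDiagram} (h : L.Equivalent L') :
    GaussDiagram.SameReduced L.toGaussDiagram L'.toGaussDiagram := by
  induction h with
  | rel _ _ h => exact h.sameReduced
  | refl _ => exact .refl _
  | symm _ _ _ h => exact h.symm
  | trans _ _ _ _ _ h h' => exact h.trans h'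

/-! ### Elements that act trivially on each other -/

section Commuting

variable {N : Type*} [AddCommGroup N] [Module ℤ[T;T⁻¹] N]

/-- $x\triangleright y-x=(1-t)(y-x)$. The condition is symmetric in `x` and `y` and independent of
the sign, so positive and negative Hopf clasps impose the same relation. -/
theorem slide_eq_self_iff (s : ℤˣ) (x y : N) :
    slide s y x = x ↔ (1 - LaurentPolynomial.T 1 : ℤ[T;T⁻¹]) • x
      = (1 - LaurentPolynomial.T 1 : ℤ[T;T⁻¹]) • y := by
  have h1 : slide 1 y x = x ↔ (1 - LaurentPolynomial.T 1 : ℤ[T;T⁻¹]) • x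
      = (1 - LaurentPolynomial.T 1 : ℤ[T;T⁻¹]) • y := by
    have : slide 1 y x = x + ((1 - LaurentPolynomial.T 1 : ℤ[T;T⁻¹]) • y
        - (1 - LaurentPolynomial.T 1 : ℤ[T;T⁻¹]) • x) := by
      rw [slide, Units.val_one]; module
    rw [this, add_eq_left, sub_eq_zero, eq_comm]
  obtain rfl | rfl := Int.units_eq_one_or s
  · exact h1
  · rw [← h1, eq_comm, slide_eq_iff, neg_neg, eq_comm]

end Commuting

namespace GaussDiagram

/-! ### The two links -/

section Colorings

variable {N : Type*} [AddCommGroup N] [Module ℤ[T;T⁻¹] N]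

/-- The coloring of two Hopf links with the given colors of the components. -/
def hopfColor (x₁ x₂ y₁ y₂ : N) : twoHopf.Pt → N :=
  (![x₁, x₁, x₂, x₂, y₁, y₁, y₂, y₂] : Fin 8 → N)

/-- The coloring of a chain and a circle with the given colors of the components. -/
def chainColor (x y z w : N) : chainAndCircle.Pt → N :=
  (![x, x, y, y, y, y, z, z, w] : Fin 9 → N)

theorem coloring_hopfColor {x₁ x₂ y₁ y₂ : N}
    (hx : (1 - LaurentPolynomial.T 1 : ℤ[T;T⁻¹]) • x₁
      = (1 - LaurentPolynomial.T 1 : ℤ[T;T⁻¹]) • x₂)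
    (hy : (1 - LaurentPolynomial.T 1 : ℤ[T;T⁻¹]) • y₁
      = (1 - LaurentPolynomial.T 1 : ℤ[T;T⁻¹]) • y₂) :
    twoHopf.Coloring (hopfColor x₁ x₂ y₁ y₂) := by
  refine ⟨fun (p : Fin 8) hp => ?_, fun (c : Fin 4) => ?_⟩
  · fin_cases p
    · exact (hp (1 : Fin 4) rfl).elim
    · rfl
    · rfl
    · exact (hp (0 : Fin 4) rfl).elim
    · exact (hp (3 : Fin 4) rfl).elim
    · rfl
    · rfl
    · exact (hp (2 : Fin 4) rfl).elim
  · fin_cases c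
    · exact ((slide_eq_self_iff (-1) _ _).2 hx.symm).symm
    · exact ((slide_eq_self_iff (-1) _ _).2 hx).symm
    · exact ((slide_eq_self_iff (-1) _ _).2 hy.symm).symm
    · exact ((slide_eq_self_iff (-1) _ _).2 hy).symm

theorem coloring_chainColor {x y z : N} (w : N)
    (hx : (1 - LaurentPolynomial.T 1 : ℤ[T;T⁻¹]) • x
      = (1 - LaurentPolynomial.T 1 : ℤ[T;T⁻¹]) • y)
    (hz : (1 - LaurentPolynomial.T 1 : ℤ[T;T⁻¹]) • z
      = (1 - LaurentPolynomial.T 1 : ℤ[T;T⁻¹]) • y) :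
    chainAndCircle.Coloring (chainColor x y z w) := by
  refine ⟨fun (p : Fin 9) hp => ?_, fun (c : Fin 4) => ?_⟩
  · fin_cases p
    · exact (hp (1 : Fin 4) rfl).elim
    · rfl
    · exact (hp (0 : Fin 4) rfl).elim
    · rfl
    · exact (hp (3 : Fin 4) rfl).elim
    · rfl
    · exact (hp (2 : Fin 4) rfl).elim
    · rfl
    · rfl
  · fin_cases c
    · exact ((slide_eq_self_iff 1 _ _).2 hx.symm).symm
    · exact ((slide_eq_self_iff 1 _ _).2 hx).symm
    · exact ((slide_eq_self_iff 1 _ _).2 hz).symm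
    · exact ((slide_eq_self_iff 1 _ _).2 hz.symm).symm

/-- Converse to `coloring_hopfColor`: the module is generated by one element per component, with one
relation per Hopf link. -/
theorem Coloring.eq_hopfColor {f : Fin 8 → N} (hf : twoHopf.Coloring f) :
    f = hopfColor (f 0) (f 2) (f 4) (f 6) ∧
      (1 - LaurentPolynomial.T 1 : ℤ[T;T⁻¹]) • f 0
        = (1 - LaurentPolynomial.T 1 : ℤ[T;T⁻¹]) • f 2 ∧
      (1 - LaurentPolynomial.T 1 : ℤ[T;T⁻¹]) • f 4
        = (1 - LaurentPolynomial.T 1 : ℤ[T;T⁻¹]) • f 6 := by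
  have hu : ∀ i : Fin 8, (∀ c : Fin 4, (![3, 0, 7, 4] : Fin 4 → Fin 8) c ≠ i) →
      f i = f (twoHopf.next.symm i) := fun i hi => hf.const i hi
  have h1 : f 1 = f 0 := hu 1 (by decide)
  have h2 : f 2 = f 3 := hu 2 (by decide)
  have h5 : f 5 = f 4 := hu 5 (by decide)
  have h6 : f 6 = f 7 := hu 6 (by decide)
  have e0 : f 0 = slide (-1) (f 2) (f 1) := hf.cross (1 : Fin 4)
  have e4 : f 4 = slide (-1) (f 6) (f 5) := hf.cross (3 : Fin 4)
  rw [h1, eq_comm, slide_eq_self_iff] at e0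
  rw [h5, eq_comm, slide_eq_self_iff] at e4
  refine ⟨funext fun p => ?_, e0, e4⟩
  fin_cases p
  exacts [rfl, h1, rfl, h2.symm, rfl, h5, rfl, h6.symm]

theorem Coloring.eq_chainColor {f : Fin 9 → N} (hf : chainAndCircle.Coloring f) :
    f = chainColor (f 0) (f 2) (f 6) (f 8) ∧
      (1 - LaurentPolynomial.T 1 : ℤ[T;T⁻¹]) • f 0
        = (1 - LaurentPolynomial.T 1 : ℤ[T;T⁻¹]) • f 2 ∧
      (1 - LaurentPolynomial.T 1 : ℤ[T;T⁻¹]) • f 6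
        = (1 - LaurentPolynomial.T 1 : ℤ[T;T⁻¹]) • f 2 := by
  have hu : ∀ i : Fin 9, (∀ c : Fin 4, (![2, 0, 6, 4] : Fin 4 → Fin 9) c ≠ i) →
      f i = f (chainAndCircle.next.symm i) := fun i hi => hf.const i hi
  have h1 : f 1 = f 0 := hu 1 (by decide)
  have h3 : f 3 = f 2 := hu 3 (by decide)
  have h5 : f 5 = f 4 := hu 5 (by decide)
  have h7 : f 7 = f 6 := hu 7 (by decide)
  have e2 : f 2 = slide 1 (f 1) (f 5) := hf.cross (0 : Fin 4)
  have e0 : f 0 = slide 1 (f 3) (f 1) := hf.cross (1 : Fin 4)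
  have e6 : f 6 = slide 1 (f 5) (f 7) := hf.cross (2 : Fin 4)
  rw [h1, h3, eq_comm, slide_eq_self_iff] at e0
  -- The middle circle has two underpasses and so at first two colors. By `e0` the color `f 0` acts
  -- trivially on `f 2`, while crossing `0` says that it takes `f 4` to `f 2`; cancelling it
  -- identifies them.
  have h4 : f 4 = f 2 := by
    refine slide_injective 1 (f 0) ?_
    rw [(slide_eq_self_iff 1 (f 2) (f 0)).2 e0.symm, ← h1, ← h5]
    exact e2.symm
  rw [h7, h5, h4, eq_comm, slide_eq_self_iff] at e6
  refine ⟨funext fun p => ?_, e0, e6⟩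
  fin_cases p
  exacts [rfl, h1, rfl, h3, h4, h5.trans h4, rfl, h7, rfl]

end Colorings

/-- The module only sees two free generators and two differences killed by $1-t$, not the component
at which a difference is attached. -/
theorem nonempty_linearEquiv_twoHopf_chainAndCircle :
    Nonempty (twoHopf.ReducedAlexanderModule ≃ₗ[ℤ[T;T⁻¹]]
      chainAndCircle.ReducedAlexanderModule) := by
  let g : Fin 8 → twoHopf.ReducedAlexanderModule := twoHopf.gen
  let g' : Fin 9 → chainAndCircle.ReducedAlexanderModule := chainAndCircle.gen
  obtain ⟨hg, hg1, hg2⟩ := Coloring.eq_hopfColor (f := g) twoHopf.coloring_gen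
  obtain ⟨hg', hg1', hg2'⟩ := Coloring.eq_chainColor (f := g') chainAndCircle.coloring_gen
  -- The difference `g' 6 - g' 2` is detached from the middle circle and attached to the split
  -- circle `8`; `hc'` moves it back.
  have hc : twoHopf.Coloring (hopfColor (g' 0) (g' 2) (g' 8) (g' 8 + (g' 6 - g' 2))) := by
    refine coloring_hopfColor hg1' ?_
    rw [smul_add, smul_sub, hg2', sub_self, add_zero]
  have hc' : chainAndCircle.Coloring (chainColor (g 0) (g 2) (g 2 + (g 6 - g 4)) (g 4)) := by
    refine coloring_chainColor _ hg1 ?_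
    rw [smul_add, smul_sub, hg2, sub_self, add_zero]
  have e : ∀ p, twoHopf.lift _ hc (g p) = hopfColor _ _ _ _ p := fun p => lift_gen hc p
  have e' : ∀ p, chainAndCircle.lift _ hc' (g' p) = chainColor _ _ _ _ p :=
    fun p => lift_gen hc' p
  refine ⟨LinearEquiv.ofLinearMap (twoHopf.lift _ hc) (chainAndCircle.lift _ hc')
    (hom_ext fun (p : Fin 9) => ?_) (hom_ext fun (p : Fin 8) => ?_)⟩
  · rw [LinearMap.comp_apply, LinearMap.id_apply]
    change twoHopf.lift _ hc (chainAndCircle.lift _ hc' (g' p)) = g' p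
    have e0 : twoHopf.lift _ hc (g 0) = g' 0 := e 0
    have e2 : twoHopf.lift _ hc (g 2) = g' 2 := e 2
    have e4 : twoHopf.lift _ hc (g 4) = g' 8 := e 4
    have e6 : twoHopf.lift _ hc (g 6) = g' 8 + (g' 6 - g' 2) := e 6
    have e3 : twoHopf.lift _ hc (g 2 + (g 6 - g 4)) = g' 6 := by
      rw [map_add, map_sub, e2, e4, e6]; abel
    refine (congrArg _ (e' p)).trans (Eq.trans ?_ (congrFun hg' p).symm)
    fin_cases p
    exacts [e0, e0, e2, e2, e2, e2, e3, e3, e4]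
  · rw [LinearMap.comp_apply, LinearMap.id_apply]
    change chainAndCircle.lift _ hc' (twoHopf.lift _ hc (g p)) = g p
    have e0 : chainAndCircle.lift _ hc' (g' 0) = g 0 := e' 0
    have e2 : chainAndCircle.lift _ hc' (g' 2) = g 2 := e' 2
    have e6 : chainAndCircle.lift _ hc' (g' 6) = g 2 + (g 6 - g 4) := e' 6
    have e8 : chainAndCircle.lift _ hc' (g' 8) = g 4 := e' 8
    have e3 : chainAndCircle.lift _ hc' (g' 8 + (g' 6 - g' 2)) = g 6 := by
      rw [map_add, map_sub, e2, e6, e8]; abel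
    refine (congrArg _ (e p)).trans (Eq.trans ?_ (congrFun hg p).symm)
    fin_cases p
    exacts [e0, e0, e2, e2, e8, e8, e3, e3]

/-! ### The quandles of the two links -/

/-- The trivial module `ℤ[t, t⁻¹] / (1 - t)`. -/
abbrev TrivialModule : Type :=
  ℤ[T;T⁻¹] ⧸ Ideal.span {(1 - LaurentPolynomial.T 1 : ℤ[T;T⁻¹])}

theorem smul_trivialModule (x : TrivialModule) :
    (1 - LaurentPolynomial.T 1 : ℤ[T;T⁻¹]) • x = 0 := by
  obtain ⟨x, rfl⟩ := Submodule.Quotient.mk_surjective _ x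
  rw [← Submodule.Quotient.mk_smul, Submodule.Quotient.mk_eq_zero, smul_eq_mul]
  exact Ideal.mul_mem_right _ _ (Ideal.subset_span rfl)

theorem one_sub_T_ne_zero : (1 - LaurentPolynomial.T 1 : ℤ[T;T⁻¹]) ≠ 0 := by
  intro h
  rw [sub_eq_zero] at h
  -- At $t=-1$ the element $1-t$ takes the value $2$.
  have := congrArg (LaurentPolynomial.eval₂ (Int.castRingHom ℤ) (-1 : ℤˣ)) h
  rw [map_one, LaurentPolynomial.eval₂_T] at this
  simp at this

instance : Nontrivial TrivialModule := by
  refine Ideal.Quotient.nontrivial_iff.2 ?_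
  rw [Ne, Ideal.span_singleton_eq_top]
  intro h
  -- At $t=1$ a unit would become $0$.
  have := h.map (LaurentPolynomial.eval₂ (Int.castRingHom ℤ) (1 : ℤˣ))
  rw [map_sub, map_one, LaurentPolynomial.eval₂_T] at this
  simp at this

/-- The module in which the reduced Alexander module of two Hopf links embeds. -/
abbrev HopfModel : Type := ℤ[T;T⁻¹] × ℤ[T;T⁻¹] × TrivialModule × TrivialModule

/-- The coloring of two Hopf links that identifies the reduced Alexander module. -/
noncomputable def hopfModelColor : twoHopf.Pt → HopfModel :=
  hopfColor (1, 0, 0, 0) (1, 0, 1, 0) (0, 1, 0, 0) (0, 1, 0, 1)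

theorem coloring_hopfModelColor : twoHopf.Coloring hopfModelColor := by
  refine coloring_hopfColor ?_ ?_ <;> simp only [Prod.smul_mk, smul_trivialModule]

/-- The map from `TrivialModule` given by an element annihilated by `1 - t`. -/
noncomputable def ofTrivialModule {N : Type*} [AddCommGroup N] [Module ℤ[T;T⁻¹] N] (u : N)
    (hu : (1 - LaurentPolynomial.T 1 : ℤ[T;T⁻¹]) • u = 0) : TrivialModule →ₗ[ℤ[T;T⁻¹]] N :=
  Submodule.liftQ _ (LinearMap.toSpanSingleton ℤ[T;T⁻¹] N u) <| by
    rw [Ideal.span, Submodule.span_le, Set.singleton_subset_iff]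
    exact hu

theorem ofTrivialModule_one {N : Type*} [AddCommGroup N] [Module ℤ[T;T⁻¹] N] (u : N)
    (hu : (1 - LaurentPolynomial.T 1 : ℤ[T;T⁻¹]) • u = 0) : ofTrivialModule u hu 1 = u :=
  one_smul _ u

theorem injective_lift_hopfModelColor :
    Function.Injective (twoHopf.lift _ coloring_hopfModelColor) := by
  let g : Fin 8 → twoHopf.ReducedAlexanderModule := twoHopf.gen
  obtain ⟨hg, hg1, hg2⟩ := Coloring.eq_hopfColor (f := g) twoHopf.coloring_gen
  have hu : (1 - LaurentPolynomial.T 1 : ℤ[T;T⁻¹]) • (g 2 - g 0) = 0 := by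
    rw [smul_sub, hg1, sub_self]
  have hv : (1 - LaurentPolynomial.T 1 : ℤ[T;T⁻¹]) • (g 6 - g 4) = 0 := by
    rw [smul_sub, hg2, sub_self]
  -- A left inverse: the free basis goes to `g 0` and `g 4`, the torsion generators to `g 2 - g 0`
  -- and `g 6 - g 4`.
  let B : HopfModel →ₗ[ℤ[T;T⁻¹]] twoHopf.ReducedAlexanderModule :=
    (LinearMap.toSpanSingleton _ _ (g 0)).coprod ((LinearMap.toSpanSingleton _ _ (g 4)).coprod
      ((ofTrivialModule _ hu).coprod (ofTrivialModule _ hv)))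
  have h : B ∘ₗ twoHopf.lift _ coloring_hopfModelColor = LinearMap.id := by
    refine hom_ext fun p => ?_
    rw [LinearMap.comp_apply, LinearMap.id_apply, lift_gen]
    have e0 : B (1, 0, 0, 0) = g 0 := by simp [B]
    have e2 : B (1, 0, 1, 0) = g 2 := by simp [B, ofTrivialModule_one]
    have e4 : B (0, 1, 0, 0) = g 4 := by simp [B]
    have e6 : B (0, 1, 0, 1) = g 6 := by simp [B, ofTrivialModule_one]
    refine Eq.trans ?_ (congrFun hg p).symm
    change Fin 8 at p
    fin_cases p
    exacts [e0, e0, e2, e2, e4, e4, e6, e6]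
  exact Function.LeftInverse.injective (g := B) fun x => LinearMap.congr_fun h x

/-- The reduction of the model modulo `1 - t`. -/
noncomputable def hopfModelReduction :
    HopfModel →ₗ[ℤ[T;T⁻¹]] TrivialModule × TrivialModule × TrivialModule × TrivialModule :=
  (Submodule.mkQ _).prodMap ((Submodule.mkQ _).prodMap LinearMap.id)

/-- The four classes of generators modulo `1 - t`. -/
def hopfClasses : Set (TrivialModule × TrivialModule × TrivialModule × TrivialModule) :=
  {(1, 0, 0, 0), (1, 0, 1, 0), (0, 1, 0, 0), (0, 1, 0, 1)}

/-- Modulo $1-t$ every operation is trivial, so an element keeps the class of a generator. -/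
theorem hopfModelReduction_mem {x : twoHopf.ReducedAlexanderModule} (hx : x ∈ twoHopf.reducedSet) :
    hopfModelReduction (twoHopf.lift _ coloring_hopfModelColor x) ∈ hopfClasses := by
  refine reducedSet_subset (S := {x | hopfModelReduction
    (twoHopf.lift _ coloring_hopfModelColor x) ∈ hopfClasses})
    (fun s x hx y _ => ?_) (fun p => ?_) hx
  · rw [Set.mem_ofPred_eq, map_slide, map_slide, (slide_eq_self_iff s _ _).2]
    · exact hx
    · simp only [Prod.smul_def, smul_trivialModule]
  · rw [Set.mem_ofPred_eq, lift_gen]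
    change Fin 8 at p
    fin_cases p <;>
      simp [hopfModelColor, hopfColor, hopfModelReduction, hopfClasses]

/-- $\Lambda$ is a domain, so $1-t$ can be cancelled in the free coordinates; the torsion
coordinates are lost. -/
theorem eq_of_smul_eq {x y : HopfModel}
    (h : (1 - LaurentPolynomial.T 1 : ℤ[T;T⁻¹]) • x
      = (1 - LaurentPolynomial.T 1 : ℤ[T;T⁻¹]) • y) : x.1 = y.1 ∧ x.2.1 = y.2.1 := by
  have h1 := congrArg Prod.fst h
  have h2 := congrArg (fun z => z.2.1) h
  simp only [Prod.smul_fst, Prod.smul_snd, smul_eq_mul] at h1 h2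
  exact ⟨mul_left_cancel₀ one_sub_T_ne_zero h1, mul_left_cancel₀ one_sub_T_ne_zero h2⟩

theorem act_eq_self_iff {D : GaussDiagram} (x y : D.ReducedQuandle) :
    y ◃ x = x ↔ (1 - LaurentPolynomial.T 1 : ℤ[T;T⁻¹]) • x.1
      = (1 - LaurentPolynomial.T 1 : ℤ[T;T⁻¹]) • y.1 :=
  Subtype.ext_iff.trans (slide_eq_self_iff 1 x.1 y.1)

/-- Pigeonhole: the first coordinate tells the two Hopf links apart, and each has only two classes.
-/
theorem hopfClasses_eq_of_fst_eq
    {a b c : TrivialModule × TrivialModule × TrivialModule × TrivialModule}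
    (ha : a ∈ hopfClasses) (hb : b ∈ hopfClasses) (hc : c ∈ hopfClasses) (hab : a.1 = b.1)
    (hac : a.1 = c.1) : a = b ∨ a = c ∨ b = c := by
  have key : ∀ w ∈ hopfClasses, (w.1 = 1 ∧ (w = (1, 0, 0, 0) ∨ w = (1, 0, 1, 0))) ∨
      (w.1 = 0 ∧ (w = (0, 1, 0, 0) ∨ w = (0, 1, 0, 1))) := by
    rintro w (rfl | rfl | rfl | rfl)
    exacts [.inl ⟨rfl, .inl rfl⟩, .inl ⟨rfl, .inr rfl⟩, .inr ⟨rfl, .inl rfl⟩,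
      .inr ⟨rfl, .inr rfl⟩]
  have h01 : (0 : TrivialModule) ≠ 1 := zero_ne_one
  have ha := key a ha
  have hb := key b hb
  have hc := key c hc
  -- Only the equalities between names matter from here on, so the tuples become opaque.
  generalize ((1, 0, 0, 0) : TrivialModule × TrivialModule × TrivialModule × TrivialModule) = p,
    ((1, 0, 1, 0) : TrivialModule × TrivialModule × TrivialModule × TrivialModule) = q,
    ((0, 1, 0, 0) : TrivialModule × TrivialModule × TrivialModule × TrivialModule) = r,
    ((0, 1, 0, 1) : TrivialModule × TrivialModule × TrivialModule × TrivialModule) = s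
    at ha hb hc
  clear key
  generalize (0 : TrivialModule) = o, (1 : TrivialModule) = i at h01 ha hb hc
  grind

/-- Among three elements of the quandle of two Hopf links that act trivially on each other, two
are equal. -/
theorem twoHopf_eq_of_act_eq {x y z : twoHopf.ReducedQuandle} (hxy : y ◃ x = x)
    (hxz : z ◃ x = x) : x = y ∨ x = z ∨ y = z := by
  rw [act_eq_self_iff] at hxy hxz
  -- The class supplies the torsion coordinates, the multiple by $1-t$ the free ones.
  have key : ∀ x y : twoHopf.ReducedQuandle,
      hopfModelReduction (twoHopf.lift _ coloring_hopfModelColor x.1) =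
        hopfModelReduction (twoHopf.lift _ coloring_hopfModelColor y.1) →
      (1 - LaurentPolynomial.T 1 : ℤ[T;T⁻¹]) • x.1
        = (1 - LaurentPolynomial.T 1 : ℤ[T;T⁻¹]) • y.1 → x = y := by
    intro x y h h'
    have h' := congrArg (twoHopf.lift _ coloring_hopfModelColor) h'
    rw [map_smul, map_smul] at h'
    obtain ⟨h1, h2⟩ := eq_of_smul_eq h'
    refine Subtype.ext (injective_lift_hopfModelColor ?_)
    exact Prod.ext h1 (Prod.ext h2 (congrArg (fun w => w.2.2) h))
  have fst : ∀ x y : twoHopf.ReducedQuandle, (1 - LaurentPolynomial.T 1 : ℤ[T;T⁻¹]) • x.1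
        = (1 - LaurentPolynomial.T 1 : ℤ[T;T⁻¹]) • y.1 →
      (hopfModelReduction (twoHopf.lift _ coloring_hopfModelColor x.1)).1 =
        (hopfModelReduction (twoHopf.lift _ coloring_hopfModelColor y.1)).1 := by
    intro x y h
    have h := congrArg (twoHopf.lift _ coloring_hopfModelColor) h
    rw [map_smul, map_smul] at h
    exact congrArg (Submodule.mkQ _) (eq_of_smul_eq h).1
  obtain h | h | h := hopfClasses_eq_of_fst_eq (hopfModelReduction_mem x.2)
    (hopfModelReduction_mem y.2) (hopfModelReduction_mem z.2) (fst x y hxy) (fst x z hxz)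
  · exact .inl (key x y h hxy)
  · exact .inr (.inl (key x z h hxz))
  · exact .inr (.inr (key y z h (hxy.symm.trans hxz)))

/-- The middle circle of the chain acts trivially on the two outer ones. Pulled back along `f`, the
three generators would have a coincidence, yet they are distinct. -/
theorem not_quandleIso_twoHopf_chainAndCircle :
    ¬ QuandleIso twoHopf.ReducedQuandle chainAndCircle.ReducedQuandle := by
  rintro ⟨f, hf⟩
  let g : Fin 9 → chainAndCircle.ReducedAlexanderModule := chainAndCircle.gen
  let q : Fin 9 → chainAndCircle.ReducedQuandle := fun p => ⟨g p, gen_mem (D := chainAndCircle) p⟩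
  obtain ⟨-, hg1, hg2⟩ := Coloring.eq_chainColor (f := g) chainAndCircle.coloring_gen
  have hact : ∀ x y : chainAndCircle.ReducedQuandle, y ◃ x = x →
      f.symm y ◃ f.symm x = f.symm x := fun x y h => f.injective <| by
    rw [hf, Equiv.apply_symm_apply, Equiv.apply_symm_apply, h]
  -- In `TrivialModule` the components can be colored independently, so colorings separate the
  -- generators.
  have hne : ∀ (x y z : TrivialModule) (i j : Fin 9),
      chainColor x y z 0 i ≠ chainColor x y z 0 j → f.symm (q i) ≠ f.symm (q j) := by
    intro x y z i j hij h
    have hc : chainAndCircle.Coloring (chainColor x y z 0) :=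
      coloring_chainColor _ (by simp only [smul_trivialModule]) (by simp only [smul_trivialModule])
    have h : g i = g j := congrArg Subtype.val (f.symm.injective h)
    have h := congrArg (chainAndCircle.lift _ hc) h
    exact hij ((lift_gen hc i).symm.trans (h.trans (lift_gen hc j)))
  obtain h | h | h := twoHopf_eq_of_act_eq
    (hact (q 2) (q 0) ((act_eq_self_iff _ _).2 hg1.symm))
    (hact (q 2) (q 6) ((act_eq_self_iff _ _).2 hg2.symm))
  · exact hne 0 1 0 2 0 (one_ne_zero (α := TrivialModule)) h
  · exact hne 0 1 0 2 6 (one_ne_zero (α := TrivialModule)) h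
  · exact hne 1 0 0 0 6 (one_ne_zero (α := TrivialModule)) h

end GaussDiagram

theorem theorem3 :
    -- both objects are invariants of oriented links
    (∀ L L' : LinkDiagram, L.Equivalent L' →
      QuandleIso L.ReducedQuandle L'.ReducedQuandle ∧
      Nonempty (L.ReducedAlexanderModule ≃ₗ[ℤ[T;T⁻¹]] L'.ReducedAlexanderModule)) ∧
    -- the quandle determines the module
    (∀ L L' : LinkDiagram, QuandleIso L.ReducedQuandle L'.ReducedQuandle →
      Nonempty (L.ReducedAlexanderModule ≃ₗ[ℤ[T;T⁻¹]] L'.ReducedAlexanderModule)) ∧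
    -- the module does not determine the quandle
    (Nonempty (LinkDiagram.twoHopf.ReducedAlexanderModule ≃ₗ[ℤ[T;T⁻¹]]
        LinkDiagram.chainAndCircle.ReducedAlexanderModule) ∧
      ¬ QuandleIso LinkDiagram.twoHopf.ReducedQuandle
        LinkDiagram.chainAndCircle.ReducedQuandle) :=
  ⟨fun _ _ h => ⟨h.sameReduced.quandleIso, ⟨h.sameReduced.choose⟩⟩,
    fun _ _ h => GaussDiagram.nonempty_linearEquiv_of_quandleIso h,
    GaussDiagram.nonempty_linearEquiv_twoHopf_chainAndCircle,
    GaussDiagram.not_quandleIso_twoHopf_chainAndCircle⟩
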